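/- Let $n\ge 1$ and let $\Omega\subset\mathbb R^n$ be a bounded domain (open, connected, non-empty) with boundary of class $C^2$ (in particular, any bounded domain with smooth boundary). Let $p:\Omega\to\mathbb R$ be continuous with $p_-=\inf_{x\in\Omega}p(x)>n$; the exponent $p$ need not be bounded above. Put $\rho(f)=\int_\Omega|f(x)|^{p(x)}\,dx\in[0,\infty]$ for measurable scalar or vector valued $f$ (with the Euclidean norm), and $\rho_{1,p}(u)=\rho(u)+\rho(|\nabla u|)$, where $\nabla u$ is the distributional gradient. Let $W^{1,p}(\Omega)$ be the space of (classes modulo a.e. equality of) measurable functions $u$ on $\Omega$ which, together with their distributional gradient, are locally integrable functions and satisfy $\rho_{1,p}(cu)<\infty$ for some $c>0$. A set $A\subseteq W^{1,p}(\Omega)$ is called $\rho_{1,p}$-closed if $u\in A$ whenever $u_j\in A$, $u\in W^{1,p}(\Omega)$ and $\rho_{1,p}(u_j-u)\to0$. Let $V_0^{1,p}(\Omega)$ be the $\rho_{1,p}$-closure of $C_0^\infty(\Omega)$, that is, the intersection of all $\rho_{1,p}$-closed subsets of $W^{1,p}(\Omega)$ that contain $C_0^\infty(\Omega)$. Let $\varphi\in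 W^{1,p}(\Omega)$ satisfy $\int_\Omega|\nabla\varphi|^p\,dx<\infty$. Then there exists one and only one $u\in W^{1,p}(\Omega)$ such that (i) $u$ is a weak solution of the Dirichlet problem $\operatorname{div}\big(p|\nabla u|^{p-2}\nabla u\big)=0$ in $\Omega$, $u|_{\partial\Omega}=\varphi$; that is, $u-\varphi\in V_0^{1,p}(\Omega)$ and $$\int_\Omega p\,|\nabla u|^{p-2}\,\nabla u\cdot\nabla\theta\,dx=0\qquad\text{for all }\theta\in C_0^\infty(\Omega),$$ where the integrand is integrable; and (ii) for every $w\in V_0^{1,p}(\Omega)$ with $\int_\Omega|\nabla(w-\varphi)|^p\,dx<\infty$, the function $p\,|\nabla u|^{p-2}\,\nabla u\cdot\nabla(w+u-\varphi)$ is integrable on $\Omega$ and $$\int_\Omega p\,|\nabla u|^{p-2}\,\nabla u\cdot\nabla(w+u-\varphi)\,dx\le0 .$$ -/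

import Mathlib

open MeasureTheory Filter Topology
open scoped ENNReal ContDiff

noncomputable section

namespace VarExp

/-- The Euclidean space of dimension `n`. -/
abbrev Space (n : ℕ) : Type := EuclideanSpace ℝ (Fin n)

variable {n : ℕ}

/-- `Ω` has a boundary of class `C²`: near each boundary point, `Ω` is the sublevel set
`{ψ < 0}` of a `C²` function `ψ` whose differential does not vanish at that point. -/
def HasC2Boundary (Ω : Set (Space n)) : Prop :=
  ∀ x₀ ∈ frontier Ω, ∃ (U : Set (Space n)) (ψ : Space n → ℝ),
    IsOpen U ∧ x₀ ∈ U ∧ ContDiffOn ℝ 2 ψ U ∧ fderiv ℝ ψ x₀ ≠ 0 ∧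
      Ω ∩ U = {x ∈ U | ψ x < 0}

/-- The test functions `C₀^∞(Ω)`: smooth functions with compact support contained in `Ω`. -/
def testFunctions (Ω : Set (Space n)) : Set (Space n → ℝ) :=
  {θ | ContDiff ℝ ∞ θ ∧ HasCompactSupport θ ∧ tsupport θ ⊆ Ω}

/-- `g` is the distributional gradient of `u` on `Ω`, both being locally integrable there. -/
def HasWeakGradient (Ω : Set (Space n)) (u : Space n → ℝ) (g : Space n → Space n) : Prop :=
  LocallyIntegrableOn u Ω ∧ LocallyIntegrableOn g Ω ∧
    ∀ θ ∈ testFunctions Ω, ∀ i : Fin n,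
      ∫ x in Ω, u x * fderiv ℝ θ x (EuclideanSpace.single i 1) = - ∫ x in Ω, g x i * θ x

open Classical in
/-- A representative of the distributional gradient of `u` on `Ω` (which is unique up to a set of
measure zero for open `Ω`); the value `0` is used if the distributional gradient is not a
function. -/
def weakGradient (Ω : Set (Space n)) (u : Space n → ℝ) : Space n → Space n :=
  if h : ∃ g, HasWeakGradient Ω u g then h.choose else 0

/-- The modular `ρ(f) = ∫_Ω |f|^{p(x)} dx ∈ [0, ∞]`, for scalar and vector valued `f`
(with the Euclidean norm). -/
def modular {F : Type*} [NormedAddCommGroup F] (Ω : Set (Space n)) (p : Space n → ℝ)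
    (f : Space n → F) : ℝ≥0∞ :=
  ∫⁻ x in Ω, ‖f x‖ₑ ^ p x

/-- The modular `ρ_{1,p}(u) = ρ(u) + ρ(|∇u|)`. -/
def sobolevModular (Ω : Set (Space n)) (p : Space n → ℝ) (u : Space n → ℝ) : ℝ≥0∞ :=
  modular Ω p u + modular Ω p (weakGradient Ω u)

/-- The variable exponent Sobolev space `W^{1,p}(Ω)`, as a set of functions (whose values
outside `Ω` are irrelevant): the functions `u` with a distributional gradient that is a function,
such that `ρ_{1,p}(c u) < ∞` for some `c > 0`. -/
def sobolevSpace (Ω : Set (Space n)) (p : Space n → ℝ) : Set (Space n → ℝ) :=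
  {u | (∃ g, HasWeakGradient Ω u g) ∧ ∃ c : ℝ, 0 < c ∧ sobolevModular Ω p (c • u) < ⊤}

/-- `A ⊆ W^{1,p}(Ω)` is `ρ_{1,p}`-closed: it contains the limit in `W^{1,p}(Ω)` of each
`ρ_{1,p}`-convergent sequence of its elements. -/
def IsModularClosed (Ω : Set (Space n)) (p : Space n → ℝ) (A : Set (Space n → ℝ)) : Prop :=
  A ⊆ sobolevSpace Ω p ∧
    ∀ (u : ℕ → Space n → ℝ) (v : Space n → ℝ), (∀ k, u k ∈ A) → v ∈ sobolevSpace Ω p →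
      Tendsto (fun k => sobolevModular Ω p (u k - v)) atTop (𝓝 0) → v ∈ A

/-- The modular closure: the intersection of all `ρ_{1,p}`-closed sets that contain `A`. -/
def modularClosure (Ω : Set (Space n)) (p : Space n → ℝ) (A : Set (Space n → ℝ)) :
    Set (Space n → ℝ) :=
  ⋂₀ {C | IsModularClosed Ω p C ∧ A ⊆ C}

/-- The space `V_0^{1,p}(Ω)`: the `ρ_{1,p}`-closure of `C₀^∞(Ω)` in `W^{1,p}(Ω)`. -/
def V0 (Ω : Set (Space n)) (p : Space n → ℝ) : Set (Space n → ℝ) :=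
  modularClosure Ω p (testFunctions Ω)

/-- The function `p |∇u|^{p-2} ∇u · ∇v`. -/
def flux (Ω : Set (Space n)) (p : Space n → ℝ) (u v : Space n → ℝ) (x : Space n) : ℝ :=
  p x * ‖weakGradient Ω u x‖ ^ (p x - 2) * inner ℝ (weakGradient Ω u x) (weakGradient Ω v x)

/-- `u ∈ W^{1,p}(Ω)` is a weak solution of `div (p |∇u|^{p-2} ∇u) = 0` in `Ω`, `u = φ` on `∂Ω`,
the boundary condition meaning that `u - φ ∈ V_0^{1,p}(Ω)`. -/
def IsSolution (Ω : Set (Space n)) (p : Space n → ℝ) (φ u : Space n → ℝ) : Prop :=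
  u ∈ sobolevSpace Ω p ∧ u - φ ∈ V0 Ω p ∧
    ∀ θ ∈ testFunctions Ω,
      IntegrableOn (flux Ω p u θ) Ω ∧ ∫ x in Ω, flux Ω p u θ x = 0

/-- `∫_Ω p |∇u|^{p-2} ∇u · ∇(w + u - φ) dx ≤ 0` for all `w ∈ V_0^{1,p}(Ω)` such that
`∫_Ω |∇(w - φ)|^p dx < ∞`. -/
def VariationalInequality (Ω : Set (Space n)) (p : Space n → ℝ) (φ u : Space n → ℝ) : Prop :=
  ∀ w ∈ V0 Ω p, modular Ω p (weakGradient Ω (w - φ)) < ⊤ →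
    IntegrableOn (flux Ω p u (w + u - φ)) Ω ∧ ∫ x in Ω, flux Ω p u (w + u - φ) x ≤ 0

end VarExp

end

/-! ### Weak gradients -/

namespace VarExp

variable {n : ℕ} {Ω : Set (Space n)}

/-! The variational inequality (ii) characterises the minimizers of the energy `∫ |∇v|^p` over `φ +
V0`, so the theorem reduces to existence and uniqueness of a minimizer. Since `V0` is symmetric,
testing (ii) with `-w` compares `u` with `φ + w`. The tangent inequality for `|·|^r` then shows that
`u` is minimal. Conversely, difference quotients of the convex energy along a segment lie below the
increment over the whole segment, and Fatou's lemma yields both the integrability of the flux and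
the sign of its integral (`first_variation`). Test functions may be added without losing finite
energy, because `p` is bounded on their supports; inserting `θ` and `-θ` into (ii) gives the
equation (i).

As `p` may be unbounded, no doubling condition is available: the modular may be infinite after
rescaling, and modular convergence need not survive multiplication by large constants. Two facts
replace it. First, `p ≥ q > 1` gives a uniform convexity inequality for `|·|^r` whose constant does
not depend on `r ≥ q`. Consequently the halved differences of gradients of a minimizing sequence
tend to zero in modular (`exists_modular_sub_le`). Second, modular convergence implies `L^q`
convergence on a set of finite measure, and `q > n` gives Morrey's bound `‖v‖_∞ ≤ C ‖∇v‖_q` on `V0`.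
So the functions converge uniformly, and small sup norms have small modular whatever `p` is.

The sequence thus converges in `ρ_{1,p}` after multiplication by `1/2`. This suffices: half the
limit lies in `V0`, and `V0` is closed under addition. Applied to two minimizers, the same convexity
estimate and Morrey's bound give uniqueness. -/

lemma integrableOn_mul_of_hasCompactSupport (hΩ : IsOpen Ω) {f k : Space n → ℝ}
    (hf : LocallyIntegrableOn f Ω) (hk : Continuous k) (hc : HasCompactSupport k)
    (hs : tsupport k ⊆ Ω) : IntegrableOn (fun x => f x * k x) Ω := by
  have h1 : IntegrableOn f (tsupport k) := hf.integrableOn_compact_subset hs hc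
  have h2 : IntegrableOn (fun x => f x * k x) (tsupport k) :=
    h1.mul_continuousOn hk.continuousOn hc
  refine h2.of_forall_sdiff_eq_zero hΩ.measurableSet fun x hx => ?_
  rw [image_eq_zero_of_notMem_tsupport hx.2, mul_zero]

lemma _root_.MeasureTheory.LocallyIntegrableOn.apply {g : Space n → Space n}
    (hg : LocallyIntegrableOn g Ω) (i : Fin n) : LocallyIntegrableOn (fun x => g x i) Ω := by
  intro x hx
  obtain ⟨t, ht, hi⟩ := hg x hx
  exact ⟨t, ht, (EuclideanSpace.proj (𝕜 := ℝ) i).integrable_comp hi⟩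

lemma contDiff_fderiv_apply {θ : Space n → ℝ} (hθ : ContDiff ℝ ∞ θ) (v : Space n) :
    ContDiff ℝ ∞ (fun x => fderiv ℝ θ x v) :=
  (hθ.fderiv_right (m := ∞) (by simp)).clm_apply contDiff_const

lemma fderiv_apply_mem_testFunctions {θ : Space n → ℝ} (hθ : θ ∈ testFunctions Ω) (v : Space n) :
    (fun x => fderiv ℝ θ x v) ∈ testFunctions Ω := by
  refine ⟨contDiff_fderiv_apply hθ.1 v, hθ.2.1.fderiv_apply ℝ v, ?_⟩
  exact (tsupport_fderiv_apply_subset ℝ v).trans hθ.2.2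

lemma integrableOn_mul_testFunction (hΩ : IsOpen Ω) {f θ : Space n → ℝ}
    (hf : LocallyIntegrableOn f Ω) (hθ : θ ∈ testFunctions Ω) :
    IntegrableOn (fun x => f x * θ x) Ω :=
  integrableOn_mul_of_hasCompactSupport hΩ hf hθ.1.continuous hθ.2.1 hθ.2.2

lemma HasWeakGradient.add (hΩ : IsOpen Ω) {u v : Space n → ℝ} {g h : Space n → Space n}
    (hu : HasWeakGradient Ω u g) (hv : HasWeakGradient Ω v h) :
    HasWeakGradient Ω (u + v) (g + h) := by
  refine ⟨hu.1.add hv.1, hu.2.1.add hv.2.1, fun θ hθ i => ?_⟩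
  have e1 := integral_add (integrableOn_mul_testFunction hΩ hu.1
    (fderiv_apply_mem_testFunctions hθ (EuclideanSpace.single i 1)))
    (integrableOn_mul_testFunction hΩ hv.1
    (fderiv_apply_mem_testFunctions hθ (EuclideanSpace.single i 1)))
  have e2 := integral_add (integrableOn_mul_testFunction hΩ (hu.2.1.apply i) hθ)
    (integrableOn_mul_testFunction hΩ (hv.2.1.apply i) hθ)
  simp only [Pi.add_apply, PiLp.add_apply, add_mul]
  rw [e1, e2, hu.2.2 θ hθ i, hv.2.2 θ hθ i, neg_add]

lemma HasWeakGradient.smul {u : Space n → ℝ} {g : Space n → Space n}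
    (hu : HasWeakGradient Ω u g) (c : ℝ) : HasWeakGradient Ω (c • u) (c • g) := by
  refine ⟨hu.1.smul c, hu.2.1.smul c, fun θ hθ i => ?_⟩
  simp only [Pi.smul_apply, PiLp.smul_apply, smul_eq_mul, mul_assoc]
  rw [integral_const_mul, integral_const_mul, hu.2.2 θ hθ i, mul_neg]

lemma HasWeakGradient.neg {u : Space n → ℝ} {g : Space n → Space n}
    (hu : HasWeakGradient Ω u g) : HasWeakGradient Ω (-u) (-g) := by
  simpa using hu.smul (-1)

lemma HasWeakGradient.sub (hΩ : IsOpen Ω) {u v : Space n → ℝ} {g h : Space n → Space n}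
    (hu : HasWeakGradient Ω u g) (hv : HasWeakGradient Ω v h) :
    HasWeakGradient Ω (u - v) (g - h) := by
  simpa [sub_eq_add_neg] using hu.add hΩ hv.neg

lemma HasWeakGradient.unique (hΩ : IsOpen Ω) {u : Space n → ℝ} {g h : Space n → Space n}
    (hg : HasWeakGradient Ω u g) (hh : HasWeakGradient Ω u h) :
    g =ᵐ[volume.restrict Ω] h := by
  have key : ∀ i, ∀ᵐ x, x ∈ Ω → g x i - h x i = 0 := fun i => by
    refine hΩ.ae_eq_zero_of_integral_contDiff_smul_eq_zero
      ((hg.2.1.apply i).sub (hh.2.1.apply i)) fun θ h1 h2 h3 => ?_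
    have hθ : θ ∈ testFunctions Ω := ⟨h1, h2, h3⟩
    rw [← setIntegral_eq_integral_of_forall_compl_eq_zero (s := Ω)]
    · have e := integral_sub (integrableOn_mul_testFunction hΩ (hg.2.1.apply i) hθ)
        (integrableOn_mul_testFunction hΩ (hh.2.1.apply i) hθ)
      have e1 := hg.2.2 θ hθ i
      have e2 := hh.2.2 θ hθ i
      simp only [smul_eq_mul, mul_comm (θ _), sub_mul]
      rw [e]; linarith
    · intro x hx
      rw [image_eq_zero_of_notMem_tsupport (fun hx' => hx (h3 hx')), zero_smul]
  rw [Filter.EventuallyEq, ae_restrict_iff' hΩ.measurableSet]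
  filter_upwards [ae_all_iff.2 key] with x hx hxΩ
  ext i
  exact sub_eq_zero.1 (hx i hxΩ)

lemma hasWeakGradient_weakGradient {u : Space n → ℝ} (h : ∃ g, HasWeakGradient Ω u g) :
    HasWeakGradient Ω u (weakGradient Ω u) := by
  rw [weakGradient, dif_pos h]
  exact h.choose_spec

/-- `weakGradient` is an arbitrary choice and so is linear in `u` only almost everywhere. This lets
an explicit gradient, such as a sum or a multiple, take its place. -/
lemma HasWeakGradient.ae_eq (hΩ : IsOpen Ω) {u : Space n → ℝ} {g : Space n → Space n}
    (hg : HasWeakGradient Ω u g) : weakGradient Ω u =ᵐ[volume.restrict Ω] g :=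
  (hasWeakGradient_weakGradient ⟨g, hg⟩).unique hΩ hg

lemma gradient_apply (θ : Space n → ℝ) (x : Space n) (i : Fin n) :
    gradient θ x i = fderiv ℝ θ x (EuclideanSpace.single i 1) := by
  have h := InnerProductSpace.toDual_symm_apply (𝕜 := ℝ) (x := EuclideanSpace.single i (1 : ℝ))
    (y := fderiv ℝ θ x)
  rw [← h, real_inner_comm, EuclideanSpace.inner_single_left]
  simp [gradient]

lemma norm_gradient (θ : Space n → ℝ) (x : Space n) : ‖gradient θ x‖ = ‖fderiv ℝ θ x‖ := by
  simp [gradient]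

lemma continuous_gradient {θ : Space n → ℝ} (hθ : ContDiff ℝ ∞ θ) : Continuous (gradient θ) :=
  (InnerProductSpace.toDual ℝ (Space n)).symm.continuous.comp (hθ.continuous_fderiv (by simp))

lemma hasWeakGradient_of_mem_testFunctions {θ : Space n → ℝ}
    (hθ : θ ∈ testFunctions Ω) : HasWeakGradient Ω θ (gradient θ) := by
  refine ⟨hθ.1.continuous.locallyIntegrable.locallyIntegrableOn _,
    (continuous_gradient hθ.1).locallyIntegrable.locallyIntegrableOn _, fun η hη i => ?_⟩
  simp only [gradient_apply]
  have hη0 : ∀ x ∉ Ω, η x = 0 := fun x hx =>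
    image_eq_zero_of_notMem_tsupport (fun h => hx (hη.2.2 h))
  have hθ0 : ∀ x ∉ Ω, θ x = 0 := fun x hx =>
    image_eq_zero_of_notMem_tsupport (fun h => hx (hθ.2.2 h))
  -- Both functions vanish off `Ω`, so the integration by parts takes place on the whole space and
  -- has no boundary term.
  rw [setIntegral_eq_integral_of_forall_compl_eq_zero (fun x hx => by rw [hθ0 x hx, zero_mul]),
    setIntegral_eq_integral_of_forall_compl_eq_zero (fun x hx => by rw [hη0 x hx, mul_zero])]
  have c1 := (fderiv_apply_mem_testFunctions hθ (EuclideanSpace.single i 1))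
  have c2 := (fderiv_apply_mem_testFunctions hη (EuclideanSpace.single i 1))
  refine integral_mul_fderiv_eq_neg_fderiv_mul_of_integrable ?_ ?_ ?_
    (fun x _ => hθ.1.differentiable (by simp) x) (fun x _ => hη.1.differentiable (by simp) x)
  · exact (c1.1.continuous.mul hη.1.continuous).integrable_of_hasCompactSupport hη.2.1.mul_left
  · exact (hθ.1.continuous.mul c2.1.continuous).integrable_of_hasCompactSupport hθ.2.1.mul_right
  · exact (hθ.1.continuous.mul hη.1.continuous).integrable_of_hasCompactSupport hη.2.1.mul_left

lemma tendsto_setIntegral_mul {f : ℕ → Space n → ℝ} {g k : Space n → ℝ}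
    (hΩ : IsOpen Ω) (hf : ∀ j, LocallyIntegrableOn (f j) Ω) (hg : LocallyIntegrableOn g Ω)
    (hk : k ∈ testFunctions Ω)
    (h : Tendsto (fun j => eLpNorm (f j - g) 1 (volume.restrict Ω)) atTop (𝓝 0)) :
    Tendsto (fun j => ∫ x in Ω, f j x * k x) atTop (𝓝 (∫ x in Ω, g x * k x)) := by
  obtain ⟨M, hM⟩ := hk.1.continuous.bounded_above_of_compact_support hk.2.1
  refine tendsto_integral_of_L1 _ (integrableOn_mul_testFunction hΩ hg hk).aestronglyMeasurable
    (Eventually.of_forall fun j => integrableOn_mul_testFunction hΩ (hf j) hk) ?_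
  have h2 : Tendsto (fun j => ENNReal.ofReal M * eLpNorm (f j - g) 1 (volume.restrict Ω))
      atTop (𝓝 0) := by
    simpa using ENNReal.Tendsto.const_mul h (Or.inr (ENNReal.ofReal_ne_top (r := M)))
  refine tendsto_of_tendsto_of_tendsto_of_le_of_le tendsto_const_nhds h2 (fun _ => zero_le)
    fun j => ?_
  simp only [eLpNorm_one_eq_lintegral_enorm]
  rw [← lintegral_const_mul' _ _ ENNReal.ofReal_ne_top]
  refine lintegral_mono fun x => ?_
  simp only [← sub_mul, enorm_mul, Pi.sub_apply]
  rw [mul_comm]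
  gcongr
  rw [← ofReal_norm]
  exact ENNReal.ofReal_le_ofReal (hM x)

lemma hasWeakGradient_of_tendsto (hΩ : IsOpen Ω) {u : ℕ → Space n → ℝ} {v : Space n → ℝ}
    {g : ℕ → Space n → Space n} {G : Space n → Space n}
    (hu : ∀ j, HasWeakGradient Ω (u j) (g j))
    (hv : MemLp v 1 (volume.restrict Ω)) (hG : MemLp G 1 (volume.restrict Ω))
    (h1 : Tendsto (fun j => eLpNorm (u j - v) 1 (volume.restrict Ω)) atTop (𝓝 0))
    (h2 : Tendsto (fun j => eLpNorm (g j - G) 1 (volume.restrict Ω)) atTop (𝓝 0)) :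
    HasWeakGradient Ω v G := by
  have hv' : LocallyIntegrableOn v Ω :=
    IntegrableOn.locallyIntegrableOn (memLp_one_iff_integrable.1 hv)
  have hG' : LocallyIntegrableOn G Ω :=
    IntegrableOn.locallyIntegrableOn (memLp_one_iff_integrable.1 hG)
  refine ⟨hv', hG', fun θ hθ i => ?_⟩
  have l1 := tendsto_setIntegral_mul hΩ (fun j => (hu j).1) hv'
    (fderiv_apply_mem_testFunctions hθ (EuclideanSpace.single i 1)) h1
  have l2 := tendsto_setIntegral_mul (f := fun j x => g j x i) (g := fun x => G x i) hΩ
    (fun j => (hu j).2.1.apply i) (hG'.apply i) hθ <| by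
    refine tendsto_of_tendsto_of_tendsto_of_le_of_le tendsto_const_nhds h2 (fun _ => zero_le)
      fun j => eLpNorm_mono fun x => ?_
    exact PiLp.norm_apply_le (g j x - G x) i
  simp only [(hu _).2.2 θ hθ i] at l1
  exact tendsto_nhds_unique l1 l2.neg

end VarExp

/-! ### The modular, the Sobolev space and the vector space `V0` -/

namespace VarExp

variable {n : ℕ} {Ω : Set (Space n)} {p : Space n → ℝ} {q : ℝ}
  {F : Type*} [NormedAddCommGroup F]

/-- `p` is measurable and bounded below by `q > 1` on the open set `Ω` of finite measure. -/
structure ExponentBound (Ω : Set (Space n)) (p : Space n → ℝ) (q : ℝ) : Prop where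
  isOpen : IsOpen Ω
  volume_lt_top : volume Ω < ⊤
  aemeasurable : AEMeasurable p (volume.restrict Ω)
  one_lt : 1 < q
  le : ∀ x ∈ Ω, q ≤ p x

namespace ExponentBound

lemma one_lt_apply (H : ExponentBound Ω p q) {x : Space n} (hx : x ∈ Ω) : 1 < p x :=
  H.one_lt.trans_le (H.le x hx)

lemma pos_apply (H : ExponentBound Ω p q) {x : Space n} (hx : x ∈ Ω) : 0 < p x :=
  zero_lt_one.trans (H.one_lt_apply hx)

lemma isFiniteMeasure (H : ExponentBound Ω p q) : IsFiniteMeasure (volume.restrict Ω) :=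
  ⟨by simpa using H.volume_lt_top⟩

lemma modular_mono {F' : Type*} [NormedAddCommGroup F'] (H : ExponentBound Ω p q)
    {f : Space n → F} {g : Space n → F'} (h : ∀ᵐ x ∂volume.restrict Ω, ‖f x‖ₑ ≤ ‖g x‖ₑ) :
    modular Ω p f ≤ modular Ω p g := by
  refine lintegral_mono_ae ?_
  filter_upwards [h, ae_restrict_mem H.isOpen.measurableSet] with x hx hxΩ
  exact ENNReal.rpow_le_rpow hx (H.pos_apply hxΩ).le

lemma aemeasurable_modular (H : ExponentBound Ω p q) {f : Space n → F}
    (hf : AEStronglyMeasurable f (volume.restrict Ω)) :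
    AEMeasurable (fun x => ‖f x‖ₑ ^ p x) (volume.restrict Ω) :=
  hf.enorm.pow H.aemeasurable

end ExponentBound

lemma modular_congr {F' : Type*} [NormedAddCommGroup F'] {f : Space n → F} {g : Space n → F'}
    (h : ∀ᵐ x ∂volume.restrict Ω, ‖f x‖ₑ = ‖g x‖ₑ) : modular Ω p f = modular Ω p g := by
  refine lintegral_congr_ae ?_
  filter_upwards [h] with x hx
  rw [hx]

namespace ExponentBound

lemma modular_smul_le [NormedSpace ℝ F] (H : ExponentBound Ω p q) {c : ℝ} (hc : |c| ≤ 1)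
    (f : Space n → F) : modular Ω p (c • f) ≤ modular Ω p f := by
  refine H.modular_mono (Eventually.of_forall fun x => ?_)
  rw [Pi.smul_apply, enorm_smul]
  refine mul_le_of_le_one_left zero_le ?_
  rw [← ofReal_norm, Real.norm_eq_abs]
  exact ENNReal.ofReal_le_one.2 hc

/-- The norm of a midpoint is at most the larger of the two norms, so no doubling constant depending
on `p` enters. -/
lemma modular_half_smul_add_le [NormedSpace ℝ F] (H : ExponentBound Ω p q) {f : Space n → F}
    (hf : AEStronglyMeasurable f (volume.restrict Ω)) (g : Space n → F) :
    modular Ω p ((1 / 2 : ℝ) • (f + g)) ≤ modular Ω p f + modular Ω p g := by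
  rw [modular, modular, modular, ← lintegral_add_left' (H.aemeasurable_modular hf)]
  refine lintegral_mono_ae ?_
  filter_upwards [ae_restrict_mem H.isOpen.measurableSet] with x hx
  have h1 : ‖((1 / 2 : ℝ) • (f + g)) x‖ₑ ≤ max ‖f x‖ₑ ‖g x‖ₑ := by
    rw [← ofReal_norm, ← ofReal_norm, ← ofReal_norm, ← ENNReal.ofReal_max]
    refine ENNReal.ofReal_le_ofReal ?_
    rw [Pi.smul_apply, norm_smul, Pi.add_apply, Real.norm_eq_abs, abs_of_pos (by norm_num)]
    have h2 := norm_add_le (f x) (g x)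
    have h3 := le_max_left ‖f x‖ ‖g x‖
    have h4 := le_max_right ‖f x‖ ‖g x‖
    linarith
  refine (ENNReal.rpow_le_rpow h1 (H.pos_apply hx).le).trans ?_
  rcases max_cases ‖f x‖ₑ ‖g x‖ₑ with ⟨h, _⟩ | ⟨h, _⟩ <;> rw [h] <;> simp

lemma sobolevModular_eq (H : ExponentBound Ω p q) {u : Space n → ℝ} {g : Space n → Space n}
    (h : HasWeakGradient Ω u g) :
    sobolevModular Ω p u = modular Ω p u + modular Ω p g := by
  rw [sobolevModular, modular_congr (f := weakGradient Ω u) (g := g)]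
  filter_upwards [h.ae_eq H.isOpen] with x hx
  rw [hx]

lemma mem_sobolevSpace_iff (H : ExponentBound Ω p q) {u : Space n → ℝ} {g : Space n → Space n}
    (h : HasWeakGradient Ω u g) :
    u ∈ sobolevSpace Ω p ↔
      ∃ c : ℝ, 0 < c ∧ modular Ω p (c • u) < ⊤ ∧ modular Ω p (c • g) < ⊤ := by
  rw [sobolevSpace, Set.mem_ofPred_eq, and_iff_right ⟨g, h⟩]
  simp only [H.sobolevModular_eq (h.smul _), ENNReal.add_lt_top]

end ExponentBound

lemma hasWeakGradient_of_mem {u : Space n → ℝ} (hu : u ∈ sobolevSpace Ω p) :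
    HasWeakGradient Ω u (weakGradient Ω u) :=
  hasWeakGradient_weakGradient hu.1

lemma HasWeakGradient.aestronglyMeasurable {u : Space n → ℝ}
    {g : Space n → Space n} (h : HasWeakGradient Ω u g) :
    AEStronglyMeasurable u (volume.restrict Ω) := h.1.aestronglyMeasurable

lemma HasWeakGradient.aestronglyMeasurable_gradient {u : Space n → ℝ}
    {g : Space n → Space n} (h : HasWeakGradient Ω u g) :
    AEStronglyMeasurable g (volume.restrict Ω) := h.2.1.aestronglyMeasurable

namespace ExponentBound

lemma modular_smul_lt_top_of_le [NormedSpace ℝ F] (H : ExponentBound Ω p q) {c d : ℝ}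
    (hc : 0 < c) (hd : |d| ≤ c) {f : Space n → F} (h : modular Ω p (c • f) < ⊤) :
    modular Ω p (d • f) < ⊤ := by
  refine lt_of_le_of_lt ?_ h
  have : d • f = (d / c) • (c • f) := by rw [smul_smul, div_mul_cancel₀ _ hc.ne']
  rw [this]
  refine H.modular_smul_le ?_ _
  rw [abs_div, abs_of_pos hc]
  exact div_le_one_of_le₀ hd hc.le

lemma sobolevSpace_add_mem (H : ExponentBound Ω p q) {u v : Space n → ℝ}
    (hu : u ∈ sobolevSpace Ω p) (hv : v ∈ sobolevSpace Ω p) : u + v ∈ sobolevSpace Ω p := by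
  have gu := hasWeakGradient_of_mem hu
  have gv := hasWeakGradient_of_mem hv
  obtain ⟨c, hc, h1, h2⟩ := (H.mem_sobolevSpace_iff gu).1 hu
  obtain ⟨d, hd, h3, h4⟩ := (H.mem_sobolevSpace_iff gv).1 hv
  have hm : 0 < min c d := lt_min hc hd
  have h5 : |min c d| ≤ c := (abs_of_pos hm).trans_le (min_le_left _ _)
  have h6 : |min c d| ≤ d := (abs_of_pos hm).trans_le (min_le_right _ _)
  refine (H.mem_sobolevSpace_iff (gu.add H.isOpen gv)).2
    ⟨1 / 2 * min c d, by positivity, ?_, ?_⟩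
  · rw [← smul_smul, smul_add]
    exact (H.modular_half_smul_add_le (gu.aestronglyMeasurable.const_smul _) _).trans_lt
      (ENNReal.add_lt_top.2 ⟨H.modular_smul_lt_top_of_le hc h5 h1,
        H.modular_smul_lt_top_of_le hd h6 h3⟩)
  · rw [← smul_smul, smul_add]
    exact (H.modular_half_smul_add_le (gu.aestronglyMeasurable_gradient.const_smul _) _).trans_lt
      (ENNReal.add_lt_top.2 ⟨H.modular_smul_lt_top_of_le hc h5 h2,
        H.modular_smul_lt_top_of_le hd h6 h4⟩)

lemma sobolevSpace_smul_mem (H : ExponentBound Ω p q) {u : Space n → ℝ}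
    (hu : u ∈ sobolevSpace Ω p) (t : ℝ) : t • u ∈ sobolevSpace Ω p := by
  have gu := hasWeakGradient_of_mem hu
  obtain ⟨c, hc, h1, h2⟩ := (H.mem_sobolevSpace_iff gu).1 hu
  have ht : |c / (|t| + 1) * t| ≤ c := by
    rw [abs_mul, abs_div, abs_of_pos hc, abs_of_pos (by positivity : 0 < |t| + 1), div_mul_eq_mul_div]
    exact div_le_of_le_mul₀ (by positivity) hc.le (by nlinarith [abs_nonneg t])
  refine (H.mem_sobolevSpace_iff (gu.smul t)).2 ⟨c / (|t| + 1), by positivity, ?_, ?_⟩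
  · rw [smul_smul]; exact H.modular_smul_lt_top_of_le hc ht h1
  · rw [smul_smul]; exact H.modular_smul_lt_top_of_le hc ht h2

lemma modular_lt_top_of_bounded (H : ExponentBound Ω p q) {f : Space n → F}
    (hf : ∀ᵐ x ∂volume.restrict Ω, ‖f x‖ₑ ≤ 1) : modular Ω p f < ⊤ := by
  have h1 : modular Ω p f ≤ ∫⁻ x in Ω, 1 := by
    refine lintegral_mono_ae ?_
    filter_upwards [ae_restrict_mem H.isOpen.measurableSet, hf] with x hx h
    exact ENNReal.rpow_le_one h (H.pos_apply hx).le
  refine h1.trans_lt ?_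
  simpa using H.volume_lt_top

/-- Dividing by `|M| + 1` brings the values below `1`, where every power stays below `1` however
large the exponent. -/
lemma exists_modular_smul_lt_top [NormedSpace ℝ F] (H : ExponentBound Ω p q) {f : Space n → F}
    {M : ℝ} (hf : ∀ᵐ x ∂volume.restrict Ω, ‖f x‖ ≤ M) :
    modular Ω p ((|M| + 1)⁻¹ • f) < ⊤ := by
  refine H.modular_lt_top_of_bounded ?_
  filter_upwards [hf] with x hx
  rw [← ofReal_norm, ENNReal.ofReal_le_one, Pi.smul_apply, norm_smul, Real.norm_eq_abs, abs_inv,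
    abs_of_pos (by positivity : 0 < |M| + 1), inv_mul_le_one₀ (by positivity)]
  linarith [le_abs_self M]

lemma testFunctions_subset_sobolevSpace (H : ExponentBound Ω p q) :
    testFunctions Ω ⊆ sobolevSpace Ω p := by
  intro θ hθ
  obtain ⟨M, hM⟩ := hθ.1.continuous.bounded_above_of_compact_support hθ.2.1
  obtain ⟨N, hN⟩ := (hθ.1.continuous_fderiv (by simp)).bounded_above_of_compact_support
    (hθ.2.1.fderiv ℝ)
  have h1 := H.exists_modular_smul_lt_top (f := θ) (Eventually.of_forall hM)
  have h2 := H.exists_modular_smul_lt_top (f := gradient θ)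
    (Eventually.of_forall fun x => (norm_gradient θ x).trans_le (hN x))
  refine (H.mem_sobolevSpace_iff (hasWeakGradient_of_mem_testFunctions hθ)).2
    ⟨min (|M| + 1)⁻¹ (|N| + 1)⁻¹, by positivity, ?_, ?_⟩
  · refine H.modular_smul_lt_top_of_le (by positivity) ?_ h1
    rw [abs_of_pos (by positivity)]; exact min_le_left _ _
  · refine H.modular_smul_lt_top_of_le (by positivity) ?_ h2
    rw [abs_of_pos (by positivity)]; exact min_le_right _ _

end ExponentBound

lemma testFunctions_add_mem {θ η : Space n → ℝ} (hθ : θ ∈ testFunctions Ω)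
    (hη : η ∈ testFunctions Ω) : θ + η ∈ testFunctions Ω :=
  ⟨hθ.1.add hη.1, hθ.2.1.add hη.2.1,
    (tsupport_add θ η).trans (Set.union_subset hθ.2.2 hη.2.2)⟩

lemma testFunctions_smul_mem {θ : Space n → ℝ} (hθ : θ ∈ testFunctions Ω) (c : ℝ) :
    c • θ ∈ testFunctions Ω :=
  ⟨hθ.1.const_smul c, hθ.2.1.smul_left (f := fun _ => c),
    (tsupport_smul_subset_right (fun _ => c) θ).trans hθ.2.2⟩

lemma zero_mem_testFunctions : (0 : Space n → ℝ) ∈ testFunctions Ω :=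
  ⟨contDiff_const, HasCompactSupport.zero, by simp [tsupport]⟩

lemma testFunctions_subset_V0 : testFunctions Ω ⊆ V0 Ω p :=
  Set.subset_sInter fun _ hC => hC.2

lemma V0_subset_of_isModularClosed {A : Set (Space n → ℝ)} (hA : IsModularClosed Ω p A)
    (h : testFunctions Ω ⊆ A) : V0 Ω p ⊆ A :=
  Set.sInter_subset_of_mem ⟨hA, h⟩

namespace ExponentBound

/-- The whole space is one of the sets intersected in the definition of `V0`; this is what places
`V0` inside `W^{1,p}`. -/
lemma isModularClosed_sobolevSpace (H : ExponentBound Ω p q) :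
    IsModularClosed Ω p (sobolevSpace Ω p) ∧ testFunctions Ω ⊆ sobolevSpace Ω p :=
  ⟨⟨subset_rfl, fun _ _ _ hv _ => hv⟩, H.testFunctions_subset_sobolevSpace⟩

lemma V0_subset_sobolevSpace (H : ExponentBound Ω p q) : V0 Ω p ⊆ sobolevSpace Ω p :=
  V0_subset_of_isModularClosed H.isModularClosed_sobolevSpace.1 H.isModularClosed_sobolevSpace.2

lemma isModularClosed_V0 (H : ExponentBound Ω p q) : IsModularClosed Ω p (V0 Ω p) :=
  ⟨H.V0_subset_sobolevSpace, fun u v hu hv h => Set.mem_sInter.2 fun C hC =>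
    hC.1.2 u v (fun k => Set.mem_sInter.1 (hu k) C hC) hv h⟩

/-- Elements of `V0` need not be limits of test functions, so a property is proved on `V0` by
showing that it defines a closed set containing the test functions. The factor is at most `1` in
modulus because only then does the modular not increase. -/
lemma V0_smul_mem_of_abs_le_one (H : ExponentBound Ω p q) {c : ℝ} (hc : |c| ≤ 1)
    {u : Space n → ℝ} (hu : u ∈ V0 Ω p) : c • u ∈ V0 Ω p := by
  have : V0 Ω p ⊆ {u | u ∈ sobolevSpace Ω p ∧ c • u ∈ V0 Ω p} := by
    refine V0_subset_of_isModularClosed ⟨fun u hu => hu.1, fun u v hu hv h => ⟨hv, ?_⟩⟩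
      fun θ hθ => ⟨H.testFunctions_subset_sobolevSpace hθ,
        testFunctions_subset_V0 (testFunctions_smul_mem hθ c)⟩
    refine H.isModularClosed_V0.2 (fun k => c • u k) _ (fun k => (hu k).2)
      (H.sobolevSpace_smul_mem hv c) ?_
    refine tendsto_of_tendsto_of_tendsto_of_le_of_le tendsto_const_nhds h (fun _ => zero_le)
      fun k => ?_
    have g := (hasWeakGradient_of_mem (hu k).1).sub H.isOpen (hasWeakGradient_of_mem hv)
    dsimp only
    rw [← smul_sub, H.sobolevModular_eq (g.smul c), H.sobolevModular_eq g]
    exact add_le_add (H.modular_smul_le hc _) (H.modular_smul_le hc _)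
  exact (this hu).2

lemma V0_add_mem_of_forall (H : ExponentBound Ω p q) {w : Space n → ℝ}
    (hw : w ∈ sobolevSpace Ω p) (h : ∀ θ ∈ testFunctions Ω, θ + w ∈ V0 Ω p)
    {u : Space n → ℝ} (hu : u ∈ V0 Ω p) : u + w ∈ V0 Ω p := by
  have : V0 Ω p ⊆ {u | u ∈ sobolevSpace Ω p ∧ u + w ∈ V0 Ω p} := by
    refine V0_subset_of_isModularClosed ⟨fun u hu => hu.1, fun u v hu hv h => ⟨hv, ?_⟩⟩
      fun θ hθ => ⟨H.testFunctions_subset_sobolevSpace hθ, h θ hθ⟩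
    refine H.isModularClosed_V0.2 (fun k => u k + w) _ (fun k => (hu k).2)
      (H.sobolevSpace_add_mem hv hw) ?_
    simpa only [add_sub_add_right_eq_sub] using h
  exact (this hu).2

/-- The closure argument is run twice: first with a fixed test function as the second summand, then
with a fixed element of `V0`. -/
lemma V0_add_mem (H : ExponentBound Ω p q) {u v : Space n → ℝ}
    (hu : u ∈ V0 Ω p) (hv : v ∈ V0 Ω p) : u + v ∈ V0 Ω p := by
  refine H.V0_add_mem_of_forall (H.V0_subset_sobolevSpace hv) (fun θ hθ => ?_) hu
  rw [add_comm]
  exact H.V0_add_mem_of_forall (H.testFunctions_subset_sobolevSpace hθ)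
    (fun η hη => testFunctions_subset_V0 (testFunctions_add_mem hη hθ)) hv

lemma V0_neg_mem (H : ExponentBound Ω p q) {u : Space n → ℝ} (hu : u ∈ V0 Ω p) :
    -u ∈ V0 Ω p := by
  simpa using H.V0_smul_mem_of_abs_le_one (c := -1) (by simp) hu

lemma V0_sub_mem (H : ExponentBound Ω p q) {u v : Space n → ℝ}
    (hu : u ∈ V0 Ω p) (hv : v ∈ V0 Ω p) : u - v ∈ V0 Ω p := by
  simpa [sub_eq_add_neg] using H.V0_add_mem hu (H.V0_neg_mem hv)

end ExponentBound

end VarExp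

/-! ### Morrey's inequality -/

namespace VarExp

variable {n : ℕ} {Ω : Set (Space n)} {p : Space n → ℝ} {q : ℝ}
  {F : Type*} [NormedAddCommGroup F]

lemma lintegral_comp_add_smul (x : Space n) {t : ℝ} (ht : 0 < t) {f : Space n → ℝ≥0∞}
    (hf : Measurable f) :
    ∫⁻ z, f (x + t • z) = ENNReal.ofReal ((t ^ n)⁻¹) * ∫⁻ z, f z := by
  have h1 := lintegral_map (μ := (volume : Measure (Space n))) (f := fun y => f (x + y))
    (g := (t • · : Space n → Space n)) (hf.comp (measurable_const_add x)) (measurable_const_smul t)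
  rw [Measure.map_addHaar_smul volume ht.ne', lintegral_smul_measure,
    lintegral_add_left_eq_self f x, finrank_euclideanSpace_fin,
    abs_of_pos (by positivity)] at h1
  rw [← h1, smul_eq_mul]

/-- Hölder's inequality on `B` produces the power of the volume. The substitution `y = x + t z`
contributes `t^(-n)` under a `q`-th root. -/
lemma setLIntegral_enorm_comp_add_smul_le {f : Space n → F} (hf : Continuous f) (hq : 1 < q)
    (B : Set (Space n)) (x : Space n) {t : ℝ} (ht : 0 < t) :
    ∫⁻ z in B, ‖f (x + t • z)‖ₑ ≤ ENNReal.ofReal (t ^ (-(n / q))) *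
      (eLpNorm f (ENNReal.ofReal q) volume * volume B ^ (1 - 1 / q)) := by
  have hq0 : 0 < q := zero_lt_one.trans hq
  have hq1 : ENNReal.ofReal q ≠ 0 := by simpa using hq0
  have hft : Continuous fun z => f (x + t • z) := by fun_prop
  have h2 : ENNReal.ofReal (t ^ (-(n / q))) = ENNReal.ofReal ((t ^ n)⁻¹) ^ (1 / q) := by
    rw [ENNReal.ofReal_rpow_of_nonneg (by positivity) (by positivity), ← Real.rpow_natCast,
      ← Real.rpow_neg ht.le, ← Real.rpow_mul ht.le]
    congr 2; ring
  calc ∫⁻ z in B, ‖f (x + t • z)‖ₑ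
      = eLpNorm (fun z => f (x + t • z)) 1 (volume.restrict B) :=
        (eLpNorm_one_eq_lintegral_enorm).symm
    _ ≤ eLpNorm (fun z => f (x + t • z)) (ENNReal.ofReal q) (volume.restrict B) *
        volume B ^ (1 - 1 / q) := by
        simpa [hq0.le] using eLpNorm_le_eLpNorm_mul_rpow_measure_univ (μ := volume.restrict B)
          (p := 1) (q := ENNReal.ofReal q) (by simpa using hq.le) hft.aestronglyMeasurable
    _ ≤ eLpNorm (fun z => f (x + t • z)) (ENNReal.ofReal q) volume *
        volume B ^ (1 - 1 / q) := by gcongr; exact Measure.restrict_le_self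
    _ = _ := by
      rw [eLpNorm_eq_lintegral_rpow_enorm_toReal hq1 ENNReal.ofReal_ne_top,
        eLpNorm_eq_lintegral_rpow_enorm_toReal hq1 ENNReal.ofReal_ne_top,
        ENNReal.toReal_ofReal hq0.le, h2, ← mul_assoc,
        ← ENNReal.mul_rpow_of_nonneg _ _ (by positivity : 0 ≤ 1 / q),
        ← lintegral_comp_add_smul x ht
          (hf.enorm.measurable.pow_const q)]

lemma enorm_le_lintegral_fderiv {θ : Space n → ℝ} (hθ : ContDiff ℝ ∞ θ) (x z : Space n) {T : ℝ}
    (hT : 0 < T) (h0 : θ (x + T • z) = 0) :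
    ‖θ x‖ₑ ≤ ∫⁻ t in Set.Ioc 0 T, ‖fderiv ℝ θ (x + t • z)‖ₑ * ‖z‖ₑ := by
  have hd : ∀ t : ℝ, HasDerivAt (fun t : ℝ => θ (x + t • z)) (fderiv ℝ θ (x + t • z) z) t := by
    intro t
    have h1 : HasDerivAt (fun t : ℝ => x + t • z) z t := by
      simpa using ((hasDerivAt_id t).smul_const z).const_add x
    exact ((hθ.differentiable (by simp)) (x + t • z)).hasFDerivAt.comp_hasDerivAt t h1
  have hc : Continuous fun t : ℝ => fderiv ℝ θ (x + t • z) z :=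
    (contDiff_fderiv_apply hθ z).continuous.comp (by fun_prop)
  have h1 := intervalIntegral.integral_eq_sub_of_hasDerivAt (fun t _ => hd t)
    (hc.intervalIntegrable 0 T)
  simp only [h0, zero_smul, add_zero, zero_sub] at h1
  rw [← enorm_neg, ← h1, intervalIntegral.integral_of_le hT.le]
  refine (enorm_integral_le_lintegral_enorm _).trans (lintegral_mono fun t => ?_)
  exact ContinuousLinearMap.le_opENorm _ _

/-- Morrey's bound for test functions. -/
lemma exists_enorm_le_eLpNorm_gradient (hn : 1 ≤ n) (hnq : (n : ℝ) < q) (hq : 1 < q)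
    (hΩ : Bornology.IsBounded Ω) :
    ∃ C : ℝ≥0∞, C ≠ ⊤ ∧ ∀ θ ∈ testFunctions Ω, ∀ x ∈ Ω,
      ‖θ x‖ₑ ≤ C * eLpNorm (gradient θ) (ENNReal.ofReal q) (volume.restrict Ω) := by
  obtain ⟨R, hR, hΩR⟩ := hΩ.subset_ball_lt 0 (0 : Space n)
  set e : Space n := EuclideanSpace.single ⟨0, hn⟩ 1 with he
  have he1 : ‖e‖ = 1 := by simp [he]
  set B : Set (Space n) := Metric.ball e (1 / 2) with hB
  -- Vectors of `B` have norm at least `1/2`, so for `‖x‖ < R` the point `x + T • z` has norm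
  -- greater than `2R - R = R` and lies outside `Ω`.
  set T : ℝ := 4 * R with hT
  have hT0 : 0 < T := by positivity
  have hq0 : 0 < q := zero_lt_one.trans hq
  have hB0 : volume B ≠ 0 := (Metric.measure_ball_pos volume e (by norm_num)).ne'
  have hBt : volume B ≠ ⊤ := measure_ball_lt_top.ne
  set K : ℝ≥0∞ := ∫⁻ t in Set.Ioc 0 T, ENNReal.ofReal (t ^ (-(n / q))) with hK
  have hKt : K ≠ ⊤ := by
    have h1 : IntervalIntegrable (fun t : ℝ => t ^ (-(n / q))) volume 0 T := by
      refine intervalIntegral.intervalIntegrable_rpow' ?_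
      rw [neg_lt_neg_iff, div_lt_one hq0]
      exact hnq
    rw [intervalIntegrable_iff_integrableOn_Ioc_of_le hT0.le] at h1
    refine (lt_of_le_of_lt (lintegral_mono fun t => ?_) h1.2).ne
    rw [← ofReal_norm]
    exact ENNReal.ofReal_le_ofReal (le_abs_self _)
  have hzB : ∀ z ∈ B, ‖z‖ ≤ 2 ∧ 1 / 2 ≤ ‖z‖ := by
    intro z hz
    rw [hB, mem_ball_iff_norm] at hz
    have h1 := norm_add_le (z - e) e
    have h2 := norm_sub_le_norm_add z (z - e)
    have h3 := norm_sub_norm_le e (e - z)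
    rw [sub_sub_cancel, norm_sub_rev] at h3
    rw [sub_add_cancel] at h1
    constructor <;> linarith
  refine ⟨(volume B)⁻¹ * (2 * (K * volume B ^ (1 - 1 / q))), ?_, ?_⟩
  · refine ENNReal.mul_ne_top (ENNReal.inv_ne_top.2 hB0) (ENNReal.mul_ne_top (by simp)
      (ENNReal.mul_ne_top hKt (ENNReal.rpow_ne_top_of_nonneg ?_ hBt)))
    rw [sub_nonneg, div_le_one hq0]; exact hq.le
  intro θ hθ x hx
  have hxR : ‖x‖ < R := by simpa using hΩR hx
  set N := eLpNorm (fderiv ℝ θ) (ENNReal.ofReal q) volume with hN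
  have hN' : N = eLpNorm (gradient θ) (ENNReal.ofReal q) (volume.restrict Ω) := by
    rw [hN, ← eLpNorm_restrict_eq_of_support_subset (s := Ω) (f := fderiv ℝ θ)]
    · exact eLpNorm_congr_norm_ae (Eventually.of_forall fun y => (norm_gradient θ y).symm)
    · exact (subset_tsupport _).trans ((tsupport_fderiv_subset ℝ).trans hθ.2.2)
  rw [← hN']
  have hDc : Continuous (fderiv ℝ θ) := hθ.1.continuous_fderiv (by simp)
  have h1 : ∀ z ∈ B, ‖θ x‖ₑ ≤ ∫⁻ t in Set.Ioc 0 T, 2 * ‖fderiv ℝ θ (x + t • z)‖ₑ := by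
    intro z hz
    refine (enorm_le_lintegral_fderiv hθ.1 x z hT0 ?_).trans (lintegral_mono fun t => ?_)
    · refine image_eq_zero_of_notMem_tsupport fun h => ?_
      have h2 : ‖x + T • z‖ < R := by simpa using hΩR (hθ.2.2 h)
      have h3 := norm_sub_norm_le (T • z) (-x)
      rw [sub_neg_eq_add, add_comm, norm_neg, norm_smul, Real.norm_eq_abs, abs_of_pos hT0] at h3
      nlinarith [(hzB z hz).2]
    · dsimp only
      rw [mul_comm]
      gcongr
      rw [← ofReal_norm]
      exact (ENNReal.ofReal_le_ofReal (hzB z hz).1).trans (by simp)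
  -- The bound along rays is averaged over the directions in `B`. After Tonelli the singular factor
  -- is `t^(-n/q)`, integrable at `0` because `n < q`.
  have h2 : volume B * ‖θ x‖ₑ ≤ 2 * (K * (N * volume B ^ (1 - 1 / q))) := by
    calc volume B * ‖θ x‖ₑ = ∫⁻ z in B, ‖θ x‖ₑ := by
          rw [setLIntegral_const, mul_comm]
      _ ≤ ∫⁻ z in B, ∫⁻ t in Set.Ioc 0 T, 2 * ‖fderiv ℝ θ (x + t • z)‖ₑ :=
          setLIntegral_mono' measurableSet_ball h1
      _ = ∫⁻ t in Set.Ioc 0 T, ∫⁻ z in B, 2 * ‖fderiv ℝ θ (x + t • z)‖ₑ := by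
          refine lintegral_lintegral_swap (Measurable.aemeasurable ?_)
          have : Continuous fun a : Space n × ℝ => fderiv ℝ θ (x + a.2 • a.1) := by fun_prop
          exact (this.enorm.measurable.const_mul 2)
      _ = 2 * ∫⁻ t in Set.Ioc 0 T, ∫⁻ z in B, ‖fderiv ℝ θ (x + t • z)‖ₑ := by
          simp only [lintegral_const_mul' 2 _ (by simp)]
      _ ≤ 2 * ∫⁻ t in Set.Ioc 0 T, ENNReal.ofReal (t ^ (-(n / q))) *
            (N * volume B ^ (1 - 1 / q)) := by
          gcongr 2 * ?_
          exact setLIntegral_mono' measurableSet_Ioc fun t ht =>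
            setLIntegral_enorm_comp_add_smul_le hDc hq B x ht.1
      _ = _ := by
          rw [lintegral_mul_const _ (by fun_prop)]
  calc ‖θ x‖ₑ = (volume B)⁻¹ * (volume B * ‖θ x‖ₑ) := by
        rw [← mul_assoc, ENNReal.inv_mul_cancel hB0 hBt, one_mul]
    _ ≤ (volume B)⁻¹ * (2 * (K * (N * volume B ^ (1 - 1 / q)))) := by gcongr
    _ = _ := by ring

end VarExp

/-! ### From the modular to `L^q`, and the Poincaré constant -/

namespace VarExp

variable {n : ℕ} {Ω : Set (Space n)} {p : Space n → ℝ} {q : ℝ}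
  {F : Type*} [NormedAddCommGroup F]

/-- If `a^r ≤ δ`, the first term suffices. Otherwise `a^r / δ` exceeds `1` and also `a^r`, hence
dominates `a^q` whether `a ≤ 1` or `a ≥ 1`. -/
lemma rpow_le_rpow_div_add_div {a δ : ℝ≥0∞} (hδ : δ ≤ 1) {q r : ℝ} (hq : 0 < q)
    (hqr : q ≤ r) : a ^ q ≤ δ ^ (q / r) + a ^ r / δ := by
  have hr : 0 < r := hq.trans_le hqr
  rcases le_or_gt (a ^ r) δ with h | h
  · refine le_add_right ?_
    have h1 := ENNReal.rpow_le_rpow h (div_nonneg hq.le hr.le)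
    rwa [← ENNReal.rpow_mul, mul_div_cancel₀ _ hr.ne'] at h1
  · refine le_add_left ?_
    rcases le_total a 1 with h1 | h1
    · refine (ENNReal.rpow_le_one h1 hq.le).trans ?_
      rw [ENNReal.le_div_iff_mul_le (Or.inr (by simpa using h.ne_bot))
        (Or.inl (hδ.trans_lt ENNReal.one_lt_top).ne), one_mul]
      exact h.le
    · refine (ENNReal.rpow_le_rpow_of_exponent_le h1 hqr).trans ?_
      rw [ENNReal.div_eq_inv_mul]
      exact le_mul_of_one_le_left zero_le (ENNReal.one_le_inv.2 hδ)

namespace ExponentBound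

lemma eLpNorm_eq (H : ExponentBound Ω p q) (f : Space n → F) :
    eLpNorm f (ENNReal.ofReal q) (volume.restrict Ω) =
      (∫⁻ x in Ω, ‖f x‖ₑ ^ q) ^ (1 / q) := by
  have hq : 0 < q := zero_lt_one.trans H.one_lt
  rw [eLpNorm_eq_lintegral_rpow_enorm_toReal (by simpa using hq) ENNReal.ofReal_ne_top,
    ENNReal.toReal_ofReal hq.le]

lemma lintegral_rpow_le (H : ExponentBound Ω p q) (f : Space n → F) {δ : ℝ≥0∞} (h0 : δ ≠ 0)
    (h1 : δ ≤ 1) : ∫⁻ x in Ω, ‖f x‖ₑ ^ q ≤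
      (∫⁻ x in Ω, δ ^ (q / p x)) + modular Ω p f / δ := by
  rw [ENNReal.div_eq_inv_mul, modular, ← lintegral_const_mul' _ _ (ENNReal.inv_ne_top.2 h0),
    ← lintegral_add_left' (aemeasurable_const.pow (H.aemeasurable.const_div q))]
  refine lintegral_mono_ae ?_
  filter_upwards [ae_restrict_mem H.isOpen.measurableSet] with x hx
  rw [← ENNReal.div_eq_inv_mul]
  exact rpow_le_rpow_div_add_div h1 (zero_lt_one.trans H.one_lt) (H.le x hx)

lemma tendsto_lintegral_rpow_div (H : ExponentBound Ω p q) :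
    Tendsto (fun k : ℕ => ∫⁻ x in Ω, ((k + 1 : ℕ) : ℝ≥0∞)⁻¹ ^ (q / p x)) atTop (𝓝 0) := by
  have hq : 0 < q := zero_lt_one.trans H.one_lt
  rw [← lintegral_zero (μ := volume.restrict Ω)]
  refine tendsto_lintegral_of_dominated_convergence' (fun _ => 1)
    (fun k => aemeasurable_const.pow (H.aemeasurable.const_div q)) (fun k => ?_)
    (by simpa using H.volume_lt_top.ne) ?_
  · filter_upwards [ae_restrict_mem H.isOpen.measurableSet] with x hx
    refine ENNReal.rpow_le_one ?_ (div_nonneg hq.le (H.pos_apply hx).le)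
    simp
  · filter_upwards [ae_restrict_mem H.isOpen.measurableSet] with x hx
    have h0 : 0 < q / p x := div_pos hq (H.pos_apply hx)
    have h1 := (ENNReal.tendsto_inv_nat_nhds_zero.comp (tendsto_add_atTop_nat 1)).ennrpow_const
      (q / p x)
    rwa [ENNReal.zero_rpow_of_pos h0] at h1

/-- Smallness of the modular implies smallness of the `L^q` norm. -/
lemma exists_eLpNorm_le (H : ExponentBound Ω p q) {ε : ℝ≥0∞} (hε : 0 < ε) :
    ∃ η : ℝ≥0∞, 0 < η ∧ ∀ f : Space n → F, modular Ω p f ≤ η →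
      eLpNorm f (ENNReal.ofReal q) (volume.restrict Ω) ≤ ε := by
  have hq : 0 < q := zero_lt_one.trans H.one_lt
  have hε' : 0 < ε ^ q / 2 := ENNReal.half_pos
    (by simp [ENNReal.rpow_eq_zero_iff, hε.ne', hq.le.not_gt])
  -- The parameter `δ` is fixed first, by dominated convergence, since `δ^(q/p)` need not be
  -- uniformly small when `p` is unbounded. The threshold for the modular is then chosen in terms of
  -- `δ`.
  obtain ⟨k, hk⟩ := ((tendsto_order.1 H.tendsto_lintegral_rpow_div).2 _ hε').exists
  set δ : ℝ≥0∞ := ((k + 1 : ℕ) : ℝ≥0∞)⁻¹ with hδ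
  have hδ0 : δ ≠ 0 := ENNReal.inv_ne_zero.2 (ENNReal.natCast_ne_top _)
  have hδ1 : δ ≤ 1 := by simp [hδ]
  refine ⟨δ * (ε ^ q / 2), ENNReal.mul_pos hδ0 hε'.ne', fun f hf => ?_⟩
  have h1 : ∫⁻ x in Ω, ‖f x‖ₑ ^ q ≤ ε ^ q := by
    refine (H.lintegral_rpow_le f hδ0 hδ1).trans ?_
    rw [← ENNReal.add_halves (ε ^ q)]
    refine add_le_add hk.le ?_
    exact ENNReal.div_le_of_le_mul' hf
  rw [H.eLpNorm_eq]
  refine (ENNReal.rpow_le_rpow h1 (by positivity)).trans ?_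
  rw [← ENNReal.rpow_mul, mul_one_div_cancel hq.ne', ENNReal.rpow_one]

lemma tendsto_eLpNorm_of_tendsto_modular (H : ExponentBound Ω p q) {ι : Type*} {l : Filter ι}
    {f : ι → Space n → F} (h : Tendsto (fun k => modular Ω p (f k)) l (𝓝 0)) :
    Tendsto (fun k => eLpNorm (f k) (ENNReal.ofReal q) (volume.restrict Ω)) l (𝓝 0) := by
  refine ENNReal.tendsto_nhds_zero.2 fun ε hε => ?_
  obtain ⟨η, hη, h1⟩ := H.exists_eLpNorm_le (F := F) hε
  filter_upwards [ENNReal.tendsto_nhds_zero.1 h η hη] with k hk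
  exact h1 _ hk

lemma memLp_of_modular_lt_top [NormedSpace ℝ F] (H : ExponentBound Ω p q) {f : Space n → F}
    (hf : AEStronglyMeasurable f (volume.restrict Ω)) {c : ℝ} (hc : 0 < c)
    (h : modular Ω p (c • f) < ⊤) : MemLp f (ENNReal.ofReal q) (volume.restrict Ω) := by
  have hq : 0 < q := zero_lt_one.trans H.one_lt
  have h1 : MemLp (c • f) (ENNReal.ofReal q) (volume.restrict Ω) := by
    refine ⟨hf.const_smul c, ?_⟩
    rw [H.eLpNorm_eq]
    refine ENNReal.rpow_lt_top_of_nonneg (by positivity) (ne_of_lt ?_)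
    refine (H.lintegral_rpow_le _ one_ne_zero le_rfl).trans_lt ?_
    simpa [ENNReal.add_lt_top] using ⟨H.volume_lt_top, h⟩
  have h2 := h1.const_smul c⁻¹
  rwa [inv_smul_smul₀ hc.ne'] at h2

lemma memLp_weakGradient (H : ExponentBound Ω p q) {u : Space n → ℝ}
    (hu : u ∈ sobolevSpace Ω p) :
    MemLp (weakGradient Ω u) (ENNReal.ofReal q) (volume.restrict Ω) := by
  have g := hasWeakGradient_of_mem hu
  obtain ⟨c, hc, _, h⟩ := (H.mem_sobolevSpace_iff g).1 hu
  exact H.memLp_of_modular_lt_top g.aestronglyMeasurable_gradient hc h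

/-- The modular is lower semicontinuous with respect to `L^r` convergence. -/
lemma modular_le_of_tendsto (H : ExponentBound Ω p q) {r : ℝ≥0∞} (hr : r ≠ 0)
    {f : ℕ → Space n → F} {g : Space n → F} {M : ℝ≥0∞}
    (hf : ∀ k, AEStronglyMeasurable (f k) (volume.restrict Ω))
    (hg : AEStronglyMeasurable g (volume.restrict Ω))
    (h : Tendsto (fun k => eLpNorm (f k - g) r (volume.restrict Ω)) atTop (𝓝 0))
    (hM : ∀ᶠ k in atTop, modular Ω p (f k) ≤ M) : modular Ω p g ≤ M := by
  obtain ⟨ns, hns, hlim⟩ :=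
    (tendstoInMeasure_of_tendsto_eLpNorm hr hf hg h).exists_seq_tendsto_ae
  calc modular Ω p g = ∫⁻ x in Ω, liminf (fun k => ‖f (ns k) x‖ₑ ^ p x) atTop := by
        refine lintegral_congr_ae ?_
        filter_upwards [hlim] with x hx
        exact ((hx.enorm).ennrpow_const (p x)).liminf_eq.symm
    _ ≤ liminf (fun k => modular Ω p (f (ns k))) atTop :=
        lintegral_liminf_le' fun k => H.aemeasurable_modular (hf _)
    _ ≤ M := by
        refine liminf_le_of_frequently_le' (Eventually.frequently ?_)
        exact hns.tendsto_atTop.eventually hM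

/-- For `t ≤ 1` and exponent at least `1`, the power of `t` is at most `t`; this holds uniformly in
the exponent. -/
lemma modular_le_eLpNorm_top_mul (H : ExponentBound Ω p q) {f : Space n → F}
    (hf : eLpNorm f ⊤ (volume.restrict Ω) ≤ 1) :
    modular Ω p f ≤ eLpNorm f ⊤ (volume.restrict Ω) * volume Ω := by
  have h1 : modular Ω p f ≤ ∫⁻ _ in Ω, eLpNorm f ⊤ (volume.restrict Ω) := by
    refine lintegral_mono_ae ?_
    filter_upwards [ae_restrict_mem H.isOpen.measurableSet,
      ae_le_eLpNormEssSup (f := f) (μ := volume.restrict Ω)] with x hx h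
    rw [← eLpNorm_exponent_top] at h
    refine le_trans ?_ h
    simpa using ENNReal.rpow_le_rpow_of_exponent_ge (h.trans hf) (H.one_lt_apply hx).le
  simpa using h1

lemma tendsto_modular_of_tendsto_eLpNorm_top (H : ExponentBound Ω p q) {f : ℕ → Space n → F}
    (h : Tendsto (fun k => eLpNorm (f k) ⊤ (volume.restrict Ω)) atTop (𝓝 0)) :
    Tendsto (fun k => modular Ω p (f k)) atTop (𝓝 0) := by
  have h1 : Tendsto (fun k => eLpNorm (f k) ⊤ (volume.restrict Ω) * volume Ω) atTop (𝓝 0) := by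
    simpa using ENNReal.Tendsto.mul_const h (Or.inr H.volume_lt_top.ne)
  refine tendsto_of_tendsto_of_tendsto_of_le_of_le' tendsto_const_nhds h1
    (Eventually.of_forall fun _ => zero_le) ?_
  filter_upwards [ENNReal.tendsto_nhds_zero.1 h 1 one_pos] with k hk
  exact H.modular_le_eLpNorm_top_mul hk

end ExponentBound

/-- `C` is an admissible constant in the inequality `‖v‖_∞ ≤ C ‖∇v‖_q` on `V_0^{1,p}(Ω)`. -/
def IsPoincareConstant (Ω : Set (Space n)) (p : Space n → ℝ) (q : ℝ) (C : ℝ≥0∞) : Prop :=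
  C ≠ ⊤ ∧ ∀ v ∈ V0 Ω p, ∀ g, HasWeakGradient Ω v g → eLpNorm v ⊤ (volume.restrict Ω) ≤
    C * eLpNorm g (ENNReal.ofReal q) (volume.restrict Ω)

/-- Morrey's inequality defines a modular-closed subset of `W^{1,p}` containing the test functions,
hence holds on `V0`. -/
lemma ExponentBound.exists_isPoincareConstant (H : ExponentBound Ω p q) (hn : 1 ≤ n)
    (hnq : (n : ℝ) < q) (hΩ : Bornology.IsBounded Ω) :
    ∃ C, IsPoincareConstant Ω p q C := by
  obtain ⟨C, hC, hθ⟩ := exists_enorm_le_eLpNorm_gradient hn hnq H.one_lt hΩ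
  refine ⟨C, hC, ?_⟩
  have hq1 : ENNReal.ofReal q ≠ 0 := by simpa using zero_lt_one.trans H.one_lt
  have hq2 : 1 ≤ ENNReal.ofReal q := by simpa using H.one_lt.le
  have key : V0 Ω p ⊆ {v | v ∈ sobolevSpace Ω p ∧ eLpNorm v ⊤ (volume.restrict Ω) ≤
      C * eLpNorm (weakGradient Ω v) (ENNReal.ofReal q) (volume.restrict Ω)} := by
    refine V0_subset_of_isModularClosed ⟨fun v hv => hv.1, fun u v hu hv h => ⟨hv, ?_⟩⟩
      fun θ hθ' => ⟨H.testFunctions_subset_sobolevSpace hθ', ?_⟩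
    · have gu := fun k => hasWeakGradient_of_mem (hu k).1
      have gv := hasWeakGradient_of_mem hv
      simp only [fun k => H.sobolevModular_eq ((gu k).sub H.isOpen gv)] at h
      have h1 := H.tendsto_eLpNorm_of_tendsto_modular <|
        tendsto_of_tendsto_of_tendsto_of_le_of_le tendsto_const_nhds h (fun _ => zero_le)
          fun k => le_self_add
      have h2 := H.tendsto_eLpNorm_of_tendsto_modular <|
        tendsto_of_tendsto_of_tendsto_of_le_of_le tendsto_const_nhds h (fun _ => zero_le)
          fun k => le_add_self
      have h3 := tendstoInMeasure_of_tendsto_eLpNorm hq1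
        (fun k => (gu k).aestronglyMeasurable) gv.aestronglyMeasurable h1
      set N := eLpNorm (weakGradient Ω v) (ENNReal.ofReal q) (volume.restrict Ω)
      -- The sup norm is lower semicontinuous under convergence in measure; the slack `1/j` absorbs
      -- the `L^q` distance between the gradients.
      have h4 : ∀ j : ℕ, eLpNorm v ⊤ (volume.restrict Ω) ≤ C * (((j : ℕ) : ℝ≥0∞)⁻¹ + N) := by
        intro j
        refine eLpNorm_le_of_tendstoInMeasure ?_ h3 (fun k => (gu k).aestronglyMeasurable)
        filter_upwards [ENNReal.tendsto_nhds_zero.1 h2 (j : ℝ≥0∞)⁻¹ (by simp)] with k hk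
        refine (hu k).2.trans ?_
        gcongr
        have h5 := eLpNorm_add_le ((gu k).aestronglyMeasurable_gradient.sub
          gv.aestronglyMeasurable_gradient) gv.aestronglyMeasurable_gradient hq2
        rw [sub_add_cancel] at h5
        exact h5.trans (by gcongr)
      have h6 : Tendsto (fun j : ℕ => C * ((j : ℝ≥0∞)⁻¹ + N)) atTop (𝓝 (C * (0 + N))) :=
        ENNReal.Tendsto.const_mul (ENNReal.tendsto_inv_nat_nhds_zero.add_const N) (Or.inr hC)
      rw [zero_add] at h6
      exact ge_of_tendsto' h6 h4
    · rw [eLpNorm_congr_ae ((hasWeakGradient_of_mem_testFunctions hθ').ae_eq H.isOpen),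
        eLpNorm_exponent_top]
      refine eLpNormEssSup_le_of_ae_enorm_bound ?_
      filter_upwards [ae_restrict_mem H.isOpen.measurableSet] with x hx
      exact hθ θ hθ' x hx
  intro v hv g hg
  rw [← eLpNorm_congr_ae (hg.ae_eq H.isOpen)]
  exact (key hv).2

end VarExp

/-! ### Convexity of powers of the norm -/

namespace VarExp

section PowersOfNorm

variable {E : Type*} [NormedAddCommGroup E] [InnerProductSpace ℝ E]

lemma norm_half_smul_add_le (a b : E) : ‖(1 / 2 : ℝ) • (a + b)‖ ≤ 1 / 2 * ‖a‖ + 1 / 2 * ‖b‖ := by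
  rw [norm_smul, Real.norm_eq_abs, abs_of_pos (by norm_num)]
  linarith [norm_add_le a b]

lemma norm_half_smul_add_rpow_le {r : ℝ} (hr : 1 ≤ r) (a b : E) :
    ‖(1 / 2 : ℝ) • (a + b)‖ ^ r ≤ 1 / 2 * ‖a‖ ^ r + 1 / 2 * ‖b‖ ^ r :=
  (Real.rpow_le_rpow (norm_nonneg _) (norm_half_smul_add_le a b) (by linarith)).trans
    ((convexOn_rpow hr).2 (norm_nonneg a) (norm_nonneg b) (by norm_num) (by norm_num) (by norm_num))

lemma norm_half_smul_sub_rpow_le {r : ℝ} (hr : 1 ≤ r) (a b : E) :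
    ‖(1 / 2 : ℝ) • (a - b)‖ ^ r ≤ 1 / 2 * ‖a‖ ^ r + 1 / 2 * ‖b‖ ^ r := by
  simpa [sub_eq_add_neg] using norm_half_smul_add_rpow_le hr a (-b)

lemma norm_half_smul_add_rpow_lt {r : ℝ} (hr : 1 < r) {a b : E} (hab : a ≠ b) :
    ‖(1 / 2 : ℝ) • (a + b)‖ ^ r < 1 / 2 * ‖a‖ ^ r + 1 / 2 * ‖b‖ ^ r := by
  by_cases h : ‖a‖ = ‖b‖
  · have h1 : ‖(1 / 2 : ℝ) • a + (1 / 2 : ℝ) • b‖ < ‖b‖ :=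
      norm_combo_lt_of_ne h.le le_rfl hab (by norm_num) (by norm_num) (by norm_num)
    rw [← smul_add] at h1
    have h2 := Real.rpow_lt_rpow (norm_nonneg _) h1 (by linarith : 0 < r)
    rw [h]; linarith
  · exact (Real.rpow_le_rpow (norm_nonneg _) (norm_half_smul_add_le a b) (by linarith)).trans_lt
      ((strictConvexOn_rpow hr).2 (norm_nonneg a) (norm_nonneg b) h (by norm_num) (by norm_num)
        (by norm_num))

lemma exists_uniform_convexity_of_sub_large [FiniteDimensional ℝ E] {q : ℝ} (hq : 1 < q) {ε : ℝ}
    (hε : 0 < ε) : ∃ δ : ℝ, 0 < δ ∧ δ ≤ 1 ∧ ∀ a b : E, 2 * ε * max ‖a‖ ‖b‖ < ‖a - b‖ →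
      ‖(1 / 2 : ℝ) • (a + b)‖ ^ q ≤ (1 - δ) * (1 / 2 * ‖a‖ ^ q + 1 / 2 * ‖b‖ ^ q) := by
  have hq0 : 0 < q := by linarith
  have hc : ∀ f : E × E → E, Continuous f → Continuous fun z => ‖f z‖ ^ q := fun f hf =>
    hf.norm.rpow_const fun _ => Or.inr hq0.le
  -- By homogeneity the larger norm may be taken to be `1`. The gap in strict midpoint convexity is
  -- then continuous and positive on a compact set, hence bounded below.
  set K : Set (E × E) := Metric.sphere 0 1 ∩ {z | 2 * ε ≤ ‖z.1 - z.2‖} with hK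
  have hKc : IsCompact K :=
    (isCompact_sphere _ _).inter_right (isClosed_le continuous_const (by fun_prop))
  obtain ⟨m, hm, hKm⟩ := hKc.exists_forall_le' (a := 0)
    (f := fun z : E × E => 1 / 2 * ‖z.1‖ ^ q + 1 / 2 * ‖z.2‖ ^ q - ‖(1 / 2 : ℝ) • (z.1 + z.2)‖ ^ q)
    (((((hc _ continuous_fst).const_mul _).add ((hc _ continuous_snd).const_mul _)).sub
      (hc (fun z => (1 / 2 : ℝ) • (z.1 + z.2)) (by fun_prop))).continuousOn) (fun z hz => by
      have : z.1 ≠ z.2 := fun h => by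
        have := hz.2
        simp only [Set.mem_ofPred_eq, h, sub_self, norm_zero] at this
        linarith
      linarith [norm_half_smul_add_rpow_lt hq this])
  refine ⟨min m 1, lt_min hm one_pos, min_le_right _ _, fun a b hab => ?_⟩
  set s : ℝ := max ‖a‖ ‖b‖ with hs
  have hs0 : 0 < s := by
    rcases (le_max_of_le_left (norm_nonneg a) : 0 ≤ max ‖a‖ ‖b‖).lt_or_eq with h | h
    · exact h
    · have ha : ‖a‖ ≤ 0 := (le_max_left _ _).trans h.symm.le
      have hb : ‖b‖ ≤ 0 := (le_max_right _ _).trans h.symm.le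
      have := norm_sub_le a b
      rw [hs, ← h] at hab
      linarith
  have hz : (s⁻¹ • a, s⁻¹ • b) ∈ K := by
    refine ⟨?_, ?_⟩
    · rw [mem_sphere_zero_iff_norm, ← Prod.smul_mk, norm_smul, Prod.norm_mk, ← hs, norm_inv,
        Real.norm_eq_abs, abs_of_pos hs0, inv_mul_cancel₀ hs0.ne']
    · rw [Set.mem_ofPred_eq, ← smul_sub, norm_smul, norm_inv, Real.norm_eq_abs, abs_of_pos hs0,
        inv_mul_eq_div, le_div_iff₀ hs0]
      exact hab.le
  have h1 := hKm _ hz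
  have hsc : ∀ x : E, ‖s⁻¹ • x‖ ^ q = (s ^ q)⁻¹ * ‖x‖ ^ q := fun x => by
    rw [norm_smul, norm_inv, Real.norm_eq_abs, abs_of_pos hs0,
      Real.mul_rpow (by positivity) (norm_nonneg _), Real.inv_rpow hs0.le]
  simp only [← smul_add, smul_comm (1 / 2 : ℝ) s⁻¹, hsc] at h1
  have hsq : 0 < s ^ q := by positivity
  have h2 : s ^ q * m ≤ 1 / 2 * ‖a‖ ^ q + 1 / 2 * ‖b‖ ^ q - ‖(1 / 2 : ℝ) • (a + b)‖ ^ q := by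
    calc s ^ q * m ≤ s ^ q * (1 / 2 * ((s ^ q)⁻¹ * ‖a‖ ^ q) + 1 / 2 * ((s ^ q)⁻¹ * ‖b‖ ^ q) -
          (s ^ q)⁻¹ * ‖(1 / 2 : ℝ) • (a + b)‖ ^ q) := by gcongr
      _ = _ := by field_simp
  have ha : ‖a‖ ^ q ≤ s ^ q := Real.rpow_le_rpow (norm_nonneg _) (le_max_left _ _) hq0.le
  have hb : ‖b‖ ^ q ≤ s ^ q := Real.rpow_le_rpow (norm_nonneg _) (le_max_right _ _) hq0.le
  have h3 : min m 1 * (1 / 2 * ‖a‖ ^ q + 1 / 2 * ‖b‖ ^ q) ≤ m * s ^ q := by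
    refine mul_le_mul (min_le_left _ _) (by linarith) (by positivity) hm.le
  linarith

/-- Uniform convexity of `‖·‖ ^ r`, with a constant that does not depend on `r ≥ q > 1`. -/
lemma exists_uniform_convexity [FiniteDimensional ℝ E] {q : ℝ} (hq : 1 < q) {ε : ℝ}
    (hε : 0 < ε) (hε1 : ε ≤ 1) : ∃ C : ℝ, 0 ≤ C ∧ ∀ r, q ≤ r → ∀ a b : E,
      ‖(1 / 2 : ℝ) • (a - b)‖ ^ r + C * ‖(1 / 2 : ℝ) • (a + b)‖ ^ r ≤
        ε * (‖a‖ ^ r + ‖b‖ ^ r) + C * (1 / 2 * ‖a‖ ^ r + 1 / 2 * ‖b‖ ^ r) := by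
  obtain ⟨δ, hδ, hδ1, h⟩ := exists_uniform_convexity_of_sub_large (E := E) hq hε
  -- Multiplied by `1/δ`, the convexity gap is at least the mean of `‖a‖^r` and `‖b‖^r`, which
  -- bounds the half-difference.
  refine ⟨δ⁻¹, by positivity, fun r hr a b => ?_⟩
  have hr1 : 1 < r := hq.trans_le hr
  have hr0 : 0 < r := by linarith
  have hA : 0 ≤ ‖a‖ ^ r := by positivity
  have hB : 0 ≤ ‖b‖ ^ r := by positivity
  rcases lt_or_ge (2 * ε * max ‖a‖ ‖b‖) ‖a - b‖ with hab | hab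
  · have h1 : ‖(1 / 2 : ℝ) • (a + b)‖ ^ r ≤ (1 - δ) * (1 / 2 * ‖a‖ ^ r + 1 / 2 * ‖b‖ ^ r) := by
      have hq0 : 0 < q := by linarith
      have hrq : 1 ≤ r / q := (one_le_div hq0).2 hr
      have e : ∀ x : E, (‖x‖ ^ q) ^ (r / q) = ‖x‖ ^ r := fun x => by
        rw [← Real.rpow_mul (norm_nonneg _), mul_div_cancel₀ _ hq0.ne']
      -- The estimate for the exponent `q` is raised to the power `r/q ≥ 1`. This keeps the factor
      -- `1 - δ`, since `(1 - δ)^(r/q) ≤ 1 - δ`, and convexity of `t^(r/q)` handles the mean.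
      have h2 := Real.rpow_le_rpow (by positivity) (h a b hab) (by linarith : 0 ≤ r / q)
      rw [e, Real.mul_rpow (by linarith) (by positivity)] at h2
      refine h2.trans (mul_le_mul ?_ ?_ (by positivity) (by linarith))
      · simpa using Real.rpow_le_rpow_of_exponent_ge' (sub_nonneg.2 hδ1) (by linarith)
          zero_le_one hrq
      · have ha : 0 ≤ ‖a‖ ^ q := by positivity
        have hb : 0 ≤ ‖b‖ ^ q := by positivity
        have h3 := (convexOn_rpow hrq).2 ha hb (by norm_num : (0 : ℝ) ≤ 1 / 2)
          (by norm_num : (0 : ℝ) ≤ 1 / 2) (by norm_num)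
        simpa only [smul_eq_mul, e] using h3
    have h2 := norm_half_smul_sub_rpow_le hr1.le a b
    have h3 : δ⁻¹ * ‖(1 / 2 : ℝ) • (a + b)‖ ^ r ≤
        δ⁻¹ * (1 / 2 * ‖a‖ ^ r + 1 / 2 * ‖b‖ ^ r) - (1 / 2 * ‖a‖ ^ r + 1 / 2 * ‖b‖ ^ r) := by
      refine (mul_le_mul_of_nonneg_left h1 (by positivity)).trans_eq ?_
      field_simp
    nlinarith
  · have h1 : ‖(1 / 2 : ℝ) • (a - b)‖ ≤ ε * max ‖a‖ ‖b‖ := by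
      rw [norm_smul, Real.norm_eq_abs, abs_of_pos (by norm_num)]
      linarith
    have h2 : ‖(1 / 2 : ℝ) • (a - b)‖ ^ r ≤ ε * (‖a‖ ^ r + ‖b‖ ^ r) := by
      refine (Real.rpow_le_rpow (norm_nonneg _) h1 hr0.le).trans ?_
      rw [Real.mul_rpow hε.le (by positivity)]
      refine mul_le_mul ?_ ?_ (by positivity) hε.le
      · simpa using Real.rpow_le_rpow_of_exponent_ge' hε.le hε1 zero_le_one hr1.le
      · rcases max_cases ‖a‖ ‖b‖ with ⟨h, _⟩ | ⟨h, _⟩ <;> rw [h] <;> linarith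
    have h3 := mul_le_mul_of_nonneg_left (norm_half_smul_add_rpow_le hr1.le a b)
      (inv_nonneg.2 hδ.le)
    linarith

lemma tendsto_slope_norm_rpow {r : ℝ} (hr : 1 < r) (a h : E) :
    Tendsto (fun t : ℝ => t⁻¹ * (‖a + t • h‖ ^ r - ‖a‖ ^ r)) (𝓝[>] 0)
      (𝓝 (r * ‖a‖ ^ (r - 2) * inner ℝ a h)) := by
  have h1 : HasDerivAt (fun t : ℝ => a + t • h) h 0 := by
    simpa using ((hasDerivAt_id (0 : ℝ)).smul_const h).const_add a
  have h2 : HasFDerivAt (fun x : E => ‖x‖ ^ r) ((r * ‖a‖ ^ (r - 2)) • innerSL ℝ a)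
      (a + (0 : ℝ) • h) := by
    simpa using hasFDerivAt_norm_rpow a hr
  simpa using (h2.comp_hasDerivAt (0 : ℝ) h1).tendsto_slope_zero_right

/-- By convexity the difference quotient at `t` is at most the one at `1`. This upper bound is what
makes Fatou's lemma applicable in `first_variation`. -/
lemma slope_norm_rpow_le {r : ℝ} (hr : 1 < r) (a h : E) {t : ℝ} (ht : 0 < t) (ht1 : t ≤ 1) :
    t⁻¹ * (‖a + t • h‖ ^ r - ‖a‖ ^ r) ≤ ‖a + h‖ ^ r - ‖a‖ ^ r := by
  rw [inv_mul_le_iff₀ ht]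
  have h1 : a + t • h = (1 - t) • a + t • (a + h) := by
    rw [smul_add, sub_smul, one_smul]; abel
  have h2 : ‖a + t • h‖ ≤ (1 - t) * ‖a‖ + t * ‖a + h‖ := by
    rw [h1]
    refine (norm_add_le _ _).trans_eq ?_
    rw [norm_smul, norm_smul, Real.norm_eq_abs, Real.norm_eq_abs, abs_of_pos ht,
      abs_of_nonneg (by linarith)]
  have h3 := (convexOn_rpow hr.le).2 (norm_nonneg a) (norm_nonneg (a + h)) (by linarith : 0 ≤ 1 - t)
    ht.le (by ring)
  have h4 := Real.rpow_le_rpow (norm_nonneg _) h2 (by linarith : 0 ≤ r)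
  simp only [smul_eq_mul] at h3
  linarith

lemma norm_rpow_add_le {r : ℝ} (hr : 1 < r) (a h : E) :
    ‖a‖ ^ r + r * ‖a‖ ^ (r - 2) * inner ℝ a h ≤ ‖a + h‖ ^ r := by
  have h1 := le_of_tendsto (tendsto_slope_norm_rpow hr a h) <| by
    filter_upwards [Ioc_mem_nhdsGT (zero_lt_one (α := ℝ))] with t ht
    exact slope_norm_rpow_le hr a h ht.1 ht.2
  linarith

end PowersOfNorm

end VarExp

/-! ### Uniform convexity of the modular and almost minimal energies -/

namespace VarExp

variable {n : ℕ} {Ω : Set (Space n)} {p : Space n → ℝ} {q : ℝ}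
  {F : Type*} [NormedAddCommGroup F]

lemma exists_tendsto_eLpNorm_of_cauchy {α : Type*} [MeasurableSpace α] {μ : Measure α}
    [CompleteSpace F] {r : ℝ≥0∞} (hr : 1 ≤ r) {f : ℕ → α → F} (hf : ∀ k, MemLp (f k) r μ)
    (h : Tendsto (fun z : ℕ × ℕ => eLpNorm (f z.1 - f z.2) r μ) atTop (𝓝 0)) :
    ∃ g, MemLp g r μ ∧ Tendsto (fun k => eLpNorm (f k - g) r μ) atTop (𝓝 0) := by
  have : Fact (1 ≤ r) := ⟨hr⟩
  have hc : CauchySeq fun k => (hf k).toLp (f k) := by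
    rw [EMetric.cauchySeq_iff]
    intro ε hε
    obtain ⟨δ, hδ, hδε⟩ := exists_between hε
    obtain ⟨⟨a, b⟩, h1⟩ := eventually_atTop.1 (ENNReal.tendsto_nhds_zero.1 h δ hδ)
    refine ⟨max a b, fun j hj k hk => ?_⟩
    rw [Lp.edist_toLp_toLp]
    exact (h1 (j, k) ⟨(le_max_left a b).trans hj, (le_max_right a b).trans hk⟩).trans_lt hδε
  obtain ⟨g, hg⟩ := cauchySeq_tendsto_of_complete hc
  refine ⟨g, Lp.memLp g, ?_⟩
  exact (Lp.tendsto_Lp_iff_tendsto_eLpNorm'' f hf g (Lp.memLp g)).1 (by simpa using hg)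

lemma tendsto_eLpNorm_one {μ : Measure (Space n)} [IsFiniteMeasure μ] {r : ℝ≥0∞} (hr : 1 ≤ r)
    {f : ℕ → Space n → F} (hf : ∀ k, AEStronglyMeasurable (f k) μ)
    (h : Tendsto (fun k => eLpNorm (f k) r μ) atTop (𝓝 0)) :
    Tendsto (fun k => eLpNorm (f k) 1 μ) atTop (𝓝 0) := by
  have hr' : r.toReal⁻¹ ≤ 1 := by
    rcases eq_or_ne r ⊤ with rfl | h'
    · simp
    · exact inv_le_one_of_one_le₀ ((ENNReal.toReal_mono h' hr).trans' (by simp))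
  have h1 : Tendsto (fun k => eLpNorm (f k) r μ * μ Set.univ ^ (1 / (1 : ℝ≥0∞).toReal -
      1 / r.toReal)) atTop (𝓝 0) := by
    have := ENNReal.Tendsto.mul_const (b := μ Set.univ ^ (1 / (1 : ℝ≥0∞).toReal - 1 / r.toReal)) h
      (Or.inr (ENNReal.rpow_ne_top_of_nonneg (by simpa using hr') (measure_ne_top μ _)))
    rwa [zero_mul] at this
  exact tendsto_of_tendsto_of_tendsto_of_le_of_le tendsto_const_nhds h1 (fun _ => zero_le)
    fun k => eLpNorm_le_eLpNorm_mul_rpow_measure_univ hr (hf k)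

lemma tendsto_eLpNorm_const_smul [NormedSpace ℝ F] {α ι : Type*} [MeasurableSpace α]
    {μ : Measure α} {l : Filter ι} {r : ℝ≥0∞} {f : ι → α → F} (c : ℝ)
    (h : Tendsto (fun k => eLpNorm (f k) r μ) l (𝓝 0)) :
    Tendsto (fun k => eLpNorm (c • f k) r μ) l (𝓝 0) := by
  simp only [eLpNorm_const_smul]
  simpa using ENNReal.Tendsto.const_mul (a := ‖c‖ₑ) h (Or.inr enorm_ne_top)

lemma enorm_rpow_eq_ofReal (a : F) {r : ℝ} (hr : 0 ≤ r) : ‖a‖ₑ ^ r = ENNReal.ofReal (‖a‖ ^ r) := by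
  rw [← ofReal_norm, ENNReal.ofReal_rpow_of_nonneg (norm_nonneg _) hr]

namespace ExponentBound

lemma exists_modular_uniform_convexity (H : ExponentBound Ω p q) {ε : ℝ} (hε : 0 < ε)
    (hε1 : ε ≤ 1) : ∃ C : ℝ, 0 ≤ C ∧ ∀ f g : Space n → Space n,
      AEStronglyMeasurable f (volume.restrict Ω) → AEStronglyMeasurable g (volume.restrict Ω) →
      modular Ω p ((1 / 2 : ℝ) • (f - g)) +
          ENNReal.ofReal C * modular Ω p ((1 / 2 : ℝ) • (f + g)) ≤
        ENNReal.ofReal (ε + C / 2) * (modular Ω p f + modular Ω p g) := by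
  obtain ⟨C, hC, h⟩ := exists_uniform_convexity (E := Space n) H.one_lt hε hε1
  refine ⟨C, hC, fun f g hf hg => ?_⟩
  simp only [modular]
  rw [← lintegral_const_mul' _ _ ENNReal.ofReal_ne_top,
    ← lintegral_add_left' (H.aemeasurable_modular ((hf.sub hg).const_smul _)),
    ← lintegral_add_left' (H.aemeasurable_modular hf),
    ← lintegral_const_mul' _ _ ENNReal.ofReal_ne_top]
  refine lintegral_mono_ae ?_
  filter_upwards [ae_restrict_mem H.isOpen.measurableSet] with x hx
  have hp := (H.pos_apply hx).le
  simp only [enorm_rpow_eq_ofReal _ hp]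
  rw [← ENNReal.ofReal_mul hC, ← ENNReal.ofReal_add (by positivity) (by positivity),
    ← ENNReal.ofReal_add (by positivity) (by positivity), ← ENNReal.ofReal_mul (by positivity)]
  refine ENNReal.ofReal_le_ofReal ?_
  have h1 := h (p x) (H.le x hx) (f x) (g x)
  simp only [Pi.smul_apply, Pi.sub_apply, Pi.add_apply]
  linarith

end ExponentBound

/-- The Dirichlet energy of `φ + h`. -/
noncomputable def energy (Ω : Set (Space n)) (p : Space n → ℝ) (φ h : Space n → ℝ) : ℝ≥0∞ :=
  modular Ω p (weakGradient Ω (φ + h))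

/-- The infimum of the Dirichlet energy over `φ + V_0^{1,p}(Ω)`. -/
noncomputable def minEnergy (Ω : Set (Space n)) (p : Space n → ℝ) (φ : Space n → ℝ) : ℝ≥0∞ :=
  ⨅ h ∈ V0 Ω p, energy Ω p φ h

lemma minEnergy_le {φ h : Space n → ℝ} (hh : h ∈ V0 Ω p) :
    minEnergy Ω p φ ≤ energy Ω p φ h := iInf₂_le h hh

namespace ExponentBound

lemma energy_eq (H : ExponentBound Ω p q) {φ h : Space n → ℝ} {g : Space n → Space n}
    (hg : HasWeakGradient Ω (φ + h) g) : energy Ω p φ h = modular Ω p g := by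
  refine modular_congr ?_
  filter_upwards [hg.ae_eq H.isOpen] with x hx
  rw [hx]

/-- The midpoint of two almost minimizers is again admissible, so its energy is at least the
minimum. Uniform convexity then leaves little room for the half-difference of the gradients. -/
lemma exists_modular_sub_le (H : ExponentBound Ω p q) {φ : Space n → ℝ}
    (hφ : φ ∈ sobolevSpace Ω p) (hm : minEnergy Ω p φ ≠ ⊤) {ε : ℝ≥0∞} (hε : 0 < ε) :
    ∃ η : ℝ≥0∞, 0 < η ∧ ∀ h ∈ V0 Ω p, ∀ k ∈ V0 Ω p, energy Ω p φ h ≤ minEnergy Ω p φ + η →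
      energy Ω p φ k ≤ minEnergy Ω p φ + η →
      modular Ω p ((1 / 2 : ℝ) • (weakGradient Ω (φ + h) - weakGradient Ω (φ + k))) ≤ ε := by
  obtain ⟨e, he0, heε⟩ : ∃ e : ℝ, 0 < e ∧ ENNReal.ofReal e ≤ ε := by
    obtain ⟨r, hr, hrε⟩ := ENNReal.lt_iff_exists_nnreal_btwn.1 hε
    exact ⟨r, by simpa using hr, by simpa using hrε.le⟩
  set m : ℝ := (minEnergy Ω p φ).toReal with hm'
  have hm0 : 0 ≤ m := ENNReal.toReal_nonneg
  have hme : minEnergy Ω p φ = ENNReal.ofReal m := (ENNReal.ofReal_toReal hm).symm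
  -- With `η ≤ 1`, the excess in the final estimate is `2 ε₁ (m + η) + C η`. The choices of `ε₁` and
  -- `η` make each term at most `e / 2`; `C` depends on `ε₁`, so `η` comes last.
  set ε₁ : ℝ := min 1 (e / (4 * (m + 1))) with hε₁
  have hε₁0 : 0 < ε₁ := lt_min one_pos (by positivity)
  have hε₁e : ε₁ * (4 * (m + 1)) ≤ e := by
    rw [← le_div_iff₀ (by positivity)]; exact min_le_right _ _
  obtain ⟨C, hC, hCle⟩ := H.exists_modular_uniform_convexity hε₁0 (min_le_left _ _)
  set η : ℝ := min 1 (e / (2 * (C + 1))) with hη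
  have hη0 : 0 < η := lt_min one_pos (by positivity)
  have hη1 : η ≤ 1 := min_le_left _ _
  have hηe : η * (2 * (C + 1)) ≤ e := by
    rw [← le_div_iff₀ (by positivity)]; exact min_le_right _ _
  refine ⟨ENNReal.ofReal η, by simpa using hη0, fun h hh k hk h1 h2 => ?_⟩
  have gh := hasWeakGradient_of_mem (H.sobolevSpace_add_mem hφ (H.V0_subset_sobolevSpace hh))
  have gk := hasWeakGradient_of_mem (H.sobolevSpace_add_mem hφ (H.V0_subset_sobolevSpace hk))
  have hmid : (1 / 2 : ℝ) • (h + k) ∈ V0 Ω p :=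
    H.V0_smul_mem_of_abs_le_one (by norm_num [abs_of_pos]) (H.V0_add_mem hh hk)
  have gmid : HasWeakGradient Ω (φ + (1 / 2 : ℝ) • (h + k))
      ((1 / 2 : ℝ) • (weakGradient Ω (φ + h) + weakGradient Ω (φ + k))) := by
    convert (gh.add H.isOpen gk).smul (1 / 2) using 1
    module
  have h3 := minEnergy_le (φ := φ) hmid
  rw [H.energy_eq gmid, hme] at h3
  have h4 := hCle _ _ gh.aestronglyMeasurable_gradient gk.aestronglyMeasurable_gradient
  rw [hme, ← ENNReal.ofReal_add hm0 hη0.le] at h1 h2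
  set X := modular Ω p ((1 / 2 : ℝ) • (weakGradient Ω (φ + h) - weakGradient Ω (φ + k)))
  have h5 : X + ENNReal.ofReal (C * m) ≤ ENNReal.ofReal e + ENNReal.ofReal (C * m) := by
    calc X + ENNReal.ofReal (C * m)
        ≤ X + ENNReal.ofReal C *
          modular Ω p ((1 / 2 : ℝ) • (weakGradient Ω (φ + h) + weakGradient Ω (φ + k))) := by
          rw [ENNReal.ofReal_mul hC]; gcongr
      _ ≤ _ := h4
      _ ≤ ENNReal.ofReal (ε₁ + C / 2) * (ENNReal.ofReal (m + η) + ENNReal.ofReal (m + η)) := by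
          gcongr
          · exact h1
          · exact h2
      _ ≤ ENNReal.ofReal e + ENNReal.ofReal (C * m) := by
          rw [← ENNReal.ofReal_add (by positivity) (by positivity),
            ← ENNReal.ofReal_mul (by positivity), ← ENNReal.ofReal_add he0.le (by positivity)]
          refine ENNReal.ofReal_le_ofReal ?_
          nlinarith
  exact ((ENNReal.add_le_add_iff_right ENNReal.ofReal_ne_top).1 h5).trans heε

end ExponentBound

end VarExp

/-! ### Existence and uniqueness of the minimizer -/

namespace VarExp

variable {n : ℕ} {Ω : Set (Space n)} {p : Space n → ℝ} {q : ℝ}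

/-- `φ + h` has minimal energy in `φ + V_0^{1,p}(Ω)`. -/
def IsEnergyMinimizer (Ω : Set (Space n)) (p : Space n → ℝ) (φ h : Space n → ℝ) : Prop :=
  h ∈ V0 Ω p ∧ energy Ω p φ h ≤ minEnergy Ω p φ

namespace ExponentBound

lemma minEnergy_ne_top (H : ExponentBound Ω p q) {φ : Space n → ℝ} (hφ : φ ∈ sobolevSpace Ω p)
    (hE : modular Ω p (weakGradient Ω φ) < ⊤) : minEnergy Ω p φ ≠ ⊤ := by
  refine ((minEnergy_le (testFunctions_subset_V0 zero_mem_testFunctions)).trans_lt ?_).ne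
  rwa [H.energy_eq (g := weakGradient Ω φ) (by simpa using hasWeakGradient_of_mem hφ)]

lemma ae_eq_of_isEnergyMinimizer (H : ExponentBound Ω p q) {C : ℝ≥0∞}
    (hC : IsPoincareConstant Ω p q C) {φ h k : Space n → ℝ} (hφ : φ ∈ sobolevSpace Ω p)
    (hE : modular Ω p (weakGradient Ω φ) < ⊤) (hh : IsEnergyMinimizer Ω p φ h)
    (hk : IsEnergyMinimizer Ω p φ k) : h =ᵐ[volume.restrict Ω] k := by
  have gh := hasWeakGradient_of_mem (H.sobolevSpace_add_mem hφ (H.V0_subset_sobolevSpace hh.1))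
  have gk := hasWeakGradient_of_mem (H.sobolevSpace_add_mem hφ (H.V0_subset_sobolevSpace hk.1))
  set f := weakGradient Ω (φ + h) - weakGradient Ω (φ + k) with hf
  -- Exact minimizers satisfy the almost-minimality condition for every `η`, hence the conclusion
  -- for every `ε`.
  have h1 : modular Ω p ((1 / 2 : ℝ) • f) ≤ 0 := by
    refine le_of_forall_gt_imp_ge_of_dense fun ε hε => ?_
    obtain ⟨η, _, h2⟩ := H.exists_modular_sub_le hφ (H.minEnergy_ne_top hφ hE) hε
    exact h2 h hh.1 k hk.1 (hh.2.trans le_self_add) (hk.2.trans le_self_add)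
  have h2 : eLpNorm ((1 / 2 : ℝ) • f) (ENNReal.ofReal q) (volume.restrict Ω) ≤ 0 := by
    refine le_of_forall_gt_imp_ge_of_dense fun ε hε => ?_
    obtain ⟨η, _, h2⟩ := H.exists_eLpNorm_le (F := Space n) hε
    exact h2 _ (h1.trans zero_le)
  have h3 : eLpNorm f (ENNReal.ofReal q) (volume.restrict Ω) = 0 := by
    rw [eLpNorm_const_smul] at h2
    simpa using h2
  have g : HasWeakGradient Ω (h - k) f := by
    simpa using gh.sub H.isOpen gk
  have h4 := hC.2 _ (H.V0_sub_mem hh.1 hk.1) f g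
  rw [h3, mul_zero, nonpos_iff_eq_zero, eLpNorm_eq_zero_iff g.aestronglyMeasurable (by simp)] at h4
  filter_upwards [h4] with x hx
  exact sub_eq_zero.1 hx

lemma exists_isEnergyMinimizer (H : ExponentBound Ω p q) {C : ℝ≥0∞}
    (hC : IsPoincareConstant Ω p q C) {φ : Space n → ℝ} (hφ : φ ∈ sobolevSpace Ω p)
    (hE : modular Ω p (weakGradient Ω φ) < ⊤) : ∃ h, IsEnergyMinimizer Ω p φ h := by
  have := H.isFiniteMeasure
  have hq : 1 ≤ ENNReal.ofReal q := by simpa using H.one_lt.le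
  have hq0 : ENNReal.ofReal q ≠ 0 := (zero_lt_one.trans_le hq).ne'
  have hm := H.minEnergy_ne_top hφ hE
  have gφ := hasWeakGradient_of_mem hφ
  have hex : ∀ k : ℕ, ∃ h ∈ V0 Ω p, energy Ω p φ h ≤ minEnergy Ω p φ + (k : ℝ≥0∞)⁻¹ := fun k => by
    have h1 : minEnergy Ω p φ < minEnergy Ω p φ + (k : ℝ≥0∞)⁻¹ :=
      ENNReal.lt_add_right hm (by simp)
    obtain ⟨h, hlt⟩ := iInf_lt_iff.1 h1
    obtain ⟨hh, hlt⟩ := iInf_lt_iff.1 hlt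
    exact ⟨h, hh, hlt.le⟩
  choose h hV hlt using hex
  have hlim : ∀ η : ℝ≥0∞, 0 < η → ∀ᶠ k in atTop, energy Ω p φ (h k) ≤ minEnergy Ω p φ + η := by
    intro η hη
    filter_upwards [ENNReal.tendsto_nhds_zero.1 ENNReal.tendsto_inv_nat_nhds_zero η hη] with k hk
    exact (hlt k).trans (by gcongr)
  have hW := fun k => H.sobolevSpace_add_mem hφ (H.V0_subset_sobolevSpace (hV k))
  set f := fun k => weakGradient Ω (φ + h k) with hf
  have gf : ∀ k, HasWeakGradient Ω (φ + h k) (f k) := fun k => hasWeakGradient_of_mem (hW k)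
  have mf := fun k => (gf k).aestronglyMeasurable_gradient
  have gd : ∀ j k, HasWeakGradient Ω (h j - h k) (f j - f k) := fun j k => by
    simpa using (gf j).sub H.isOpen (gf k)
  -- the sequence is Cauchy
  have c1 : Tendsto (fun z : ℕ × ℕ => modular Ω p ((1 / 2 : ℝ) • (f z.1 - f z.2))) atTop (𝓝 0) := by
    refine ENNReal.tendsto_nhds_zero.2 fun ε hε => ?_
    obtain ⟨η, hη, h1⟩ := H.exists_modular_sub_le hφ hm hε
    obtain ⟨N, hN⟩ := eventually_atTop.1 (hlim η hη)
    filter_upwards [eventually_ge_atTop (N, N)] with z hz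
    exact h1 _ (hV _) _ (hV _) (hN _ hz.1) (hN _ hz.2)
  have c2 : Tendsto (fun z : ℕ × ℕ => eLpNorm (f z.1 - f z.2) (ENNReal.ofReal q)
      (volume.restrict Ω)) atTop (𝓝 0) := by
    simpa [smul_smul] using tendsto_eLpNorm_const_smul 2 (H.tendsto_eLpNorm_of_tendsto_modular c1)
  have c3 : Tendsto (fun z : ℕ × ℕ => eLpNorm (h z.1 - h z.2) ⊤ (volume.restrict Ω))
      atTop (𝓝 0) := by
    have h1 := ENNReal.Tendsto.const_mul (a := C) c2 (Or.inr hC.1)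
    rw [mul_zero] at h1
    exact tendsto_of_tendsto_of_tendsto_of_le_of_le tendsto_const_nhds h1 (fun _ => zero_le)
      fun z => hC.2 _ (H.V0_sub_mem (hV _) (hV _)) _ (gd _ _)
  obtain ⟨G, hG, hfG⟩ := exists_tendsto_eLpNorm_of_cauchy hq (fun k => H.memLp_weakGradient (hW k)) c2
  have hbd : ∀ k, MemLp (h k) ⊤ (volume.restrict Ω) := fun k => by
    have g := hasWeakGradient_of_mem (H.V0_subset_sobolevSpace (hV k))
    exact ⟨g.aestronglyMeasurable, (hC.2 _ (hV k) _ g).trans_lt (ENNReal.mul_lt_top hC.1.lt_top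
      (H.memLp_weakGradient (H.V0_subset_sobolevSpace (hV k))).2)⟩
  obtain ⟨v, hv, hhv⟩ := exists_tendsto_eLpNorm_of_cauchy le_top hbd c3
  -- the limit has a weak gradient
  obtain ⟨c, hc, hc1, _⟩ := (H.mem_sobolevSpace_iff gφ).1 hφ
  have hφ1 : MemLp φ 1 (volume.restrict Ω) :=
    (H.memLp_of_modular_lt_top gφ.aestronglyMeasurable hc hc1).mono_exponent hq
  have gv : HasWeakGradient Ω (φ + v) G := by
    refine hasWeakGradient_of_tendsto H.isOpen gf (hφ1.add (hv.mono_exponent le_top))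
      (hG.mono_exponent hq) ?_ (tendsto_eLpNorm_one hq (fun k => (mf k).sub hG.1) hfG)
    simp only [add_sub_add_left_eq_sub]
    exact tendsto_eLpNorm_one le_top (fun k => (hbd k).1.sub hv.1) hhv
  have gdv : ∀ k, HasWeakGradient Ω (h k - v) (f k - G) := fun k => by
    simpa using (gf k).sub H.isOpen gv
  -- convergence of the modulars
  have l1 : Tendsto (fun k => modular Ω p ((1 / 2 : ℝ) • (h k - v))) atTop (𝓝 0) :=
    H.tendsto_modular_of_tendsto_eLpNorm_top (tendsto_eLpNorm_const_smul _ hhv)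
  have l2 : Tendsto (fun k => modular Ω p ((1 / 2 : ℝ) • (f k - G))) atTop (𝓝 0) := by
    refine ENNReal.tendsto_nhds_zero.2 fun ε hε => ?_
    obtain ⟨⟨a, b⟩, h1⟩ := eventually_atTop.1 (ENNReal.tendsto_nhds_zero.1 c1 ε hε)
    -- With `j` fixed, the Cauchy estimate passes to the limit in `k` by lower semicontinuity of the
    -- modular.
    filter_upwards [eventually_ge_atTop a] with j hj
    refine H.modular_le_of_tendsto hq0 (f := fun k => (1 / 2 : ℝ) • (f j - f k))
      (fun k => ((mf j).sub (mf k)).const_smul _) (((mf j).sub hG.1).const_smul _) ?_ ?_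
    · have h2 := tendsto_eLpNorm_const_smul (-1 / 2) hfG
      refine h2.congr fun k => ?_
      congr 1
      module
    · filter_upwards [eventually_ge_atTop b] with k hk
      exact h1 (j, k) ⟨hj, hk⟩
  have hvW : v ∈ sobolevSpace Ω p := by
    obtain ⟨k, hk1, hk2⟩ := ((ENNReal.tendsto_nhds_zero.1 l1 1 one_pos).and
      (ENNReal.tendsto_nhds_zero.1 l2 1 one_pos)).exists
    have h1 : h k - v ∈ sobolevSpace Ω p := (H.mem_sobolevSpace_iff (gdv k)).2
      ⟨1 / 2, by norm_num, hk1.trans_lt ENNReal.one_lt_top, hk2.trans_lt ENNReal.one_lt_top⟩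
    have h2 := H.sobolevSpace_add_mem (H.V0_subset_sobolevSpace (hV k))
      (H.sobolevSpace_smul_mem h1 (-1))
    convert h2 using 1
    module
  -- Modular convergence is known only for the halved sequence, so the closedness of `V0` is applied
  -- to `v / 2`; then `v = v / 2 + v / 2` is recovered by addition.
  have hv2 : (1 / 2 : ℝ) • v ∈ V0 Ω p := by
    refine H.isModularClosed_V0.2 (fun k => (1 / 2 : ℝ) • h k) _
      (fun k => H.V0_smul_mem_of_abs_le_one (by norm_num [abs_of_pos]) (hV k))
      (H.sobolevSpace_smul_mem hvW _) ?_
    have h1 := l1.add l2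
    rw [add_zero] at h1
    refine h1.congr fun k => ?_
    rw [← smul_sub, H.sobolevModular_eq ((gdv k).smul (1 / 2))]
  refine ⟨v, ?_, ?_⟩
  · convert H.V0_add_mem hv2 hv2 using 1
    module
  · rw [H.energy_eq gv]
    refine le_of_forall_gt_imp_ge_of_dense fun M hM => ?_
    refine H.modular_le_of_tendsto hq0 mf hG.1 hfG ?_
    filter_upwards [hlim _ (tsub_pos_of_lt hM)] with k hk
    rwa [add_tsub_cancel_of_le hM.le] at hk

end ExponentBound

end VarExp

/-! ### The variational inequality and the weak equation -/

namespace VarExp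

variable {n : ℕ} {Ω : Set (Space n)} {p : Space n → ℝ} {q : ℝ}

lemma HasWeakGradient.flux_ae_eq (hΩ : IsOpen Ω) {u v : Space n → ℝ} {a b : Space n → Space n}
    (hu : HasWeakGradient Ω u a) (hv : HasWeakGradient Ω v b) :
    flux Ω p u v =ᵐ[volume.restrict Ω]
      fun x => p x * ‖a x‖ ^ (p x - 2) * inner ℝ (a x) (b x) := by
  filter_upwards [hu.ae_eq hΩ, hv.ae_eq hΩ] with x h1 h2
  rw [flux, h1, h2]

namespace ExponentBound

lemma modular_eq_lintegral_ofReal {F : Type*} [NormedAddCommGroup F] (H : ExponentBound Ω p q)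
    (f : Space n → F) : modular Ω p f = ∫⁻ x in Ω, ENNReal.ofReal (‖f x‖ ^ p x) := by
  refine lintegral_congr_ae ?_
  filter_upwards [ae_restrict_mem H.isOpen.measurableSet] with x hx
  exact enorm_rpow_eq_ofReal _ (H.pos_apply hx).le

lemma integrable_norm_rpow {F : Type*} [NormedAddCommGroup F] (H : ExponentBound Ω p q)
    {f : Space n → F} (hf : AEStronglyMeasurable f (volume.restrict Ω))
    (h : modular Ω p f < ⊤) : Integrable (fun x => ‖f x‖ ^ p x) (volume.restrict Ω) := by
  refine ⟨(hf.norm.aemeasurable.pow H.aemeasurable).aestronglyMeasurable, ?_⟩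
  rwa [hasFiniteIntegral_iff_ofReal (Eventually.of_forall fun x => by positivity),
    ← H.modular_eq_lintegral_ofReal]

lemma modular_eq_ofReal_integral {F : Type*} [NormedAddCommGroup F] (H : ExponentBound Ω p q)
    {f : Space n → F} (hf : AEStronglyMeasurable f (volume.restrict Ω))
    (h : modular Ω p f < ⊤) : modular Ω p f = ENNReal.ofReal (∫ x in Ω, ‖f x‖ ^ p x) := by
  rw [H.modular_eq_lintegral_ofReal, ofReal_integral_eq_lintegral_ofReal
    (H.integrable_norm_rpow hf h) (Eventually.of_forall fun x => by positivity)]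

/-- First variation of the modular at `a` in the direction `k`, if `a` is minimal on the segment
from `a` to `a + k`. -/
lemma first_variation (H : ExponentBound Ω p q) {a k : Space n → Space n}
    (ha : AEStronglyMeasurable a (volume.restrict Ω))
    (hk : AEStronglyMeasurable k (volume.restrict Ω))
    (hA : modular Ω p a < ⊤) (hB : modular Ω p (a + k) < ⊤)
    (hmin : ∀ t : ℝ, 0 < t → t ≤ 1 → modular Ω p a ≤ modular Ω p (a + t • k)) :
    IntegrableOn (fun x => p x * ‖a x‖ ^ (p x - 2) * inner ℝ (a x) (k x)) Ω ∧
      0 ≤ ∫ x in Ω, p x * ‖a x‖ ^ (p x - 2) * inner ℝ (a x) (k x) := by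
  set μ := volume.restrict Ω with hμ
  set D := fun x => p x * ‖a x‖ ^ (p x - 2) * inner ℝ (a x) (k x) with hD
  have hDm : AEStronglyMeasurable D μ :=
    ((H.aemeasurable.mul (ha.norm.aemeasurable.pow (H.aemeasurable.sub_const 2))).mul
      (ha.inner hk).aemeasurable).aestronglyMeasurable
  have iA := H.integrable_norm_rpow ha hA
  have iB := H.integrable_norm_rpow (ha.add hk) hB
  set S : ℝ → Space n → ℝ := fun t x => t⁻¹ * (‖a x + t • k x‖ ^ p x - ‖a x‖ ^ p x) with hS
  set Q : Space n → ℝ := fun x => ‖(a + k) x‖ ^ p x - ‖a x‖ ^ p x with hQ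
  have iQ : Integrable Q μ := iB.sub iA
  have hSQ : ∀ t : ℝ, 0 < t → t ≤ 1 → ∀ᵐ x ∂μ, S t x ≤ Q x := fun t ht ht1 => by
    filter_upwards [ae_restrict_mem H.isOpen.measurableSet] with x hx
    exact slope_norm_rpow_le (H.one_lt_apply hx) _ _ ht ht1
  -- Minimality gives `∫ S t ≥ 0`, so the nonnegative functions `Q - S t` have integrals bounded by
  -- `∫ Q` uniformly in `t`.
  have bound : ∀ t : ℝ, 0 < t → t ≤ 1 → AEMeasurable (S t) μ ∧
      ∫⁻ x, ENNReal.ofReal (Q x - S t x) ∂μ ≤ ENNReal.ofReal (∫ x, Q x ∂μ) := by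
    intro t ht ht1
    have hm : AEStronglyMeasurable (a + t • k) μ := ha.add (hk.const_smul t)
    have hfin : modular Ω p (a + t • k) < ⊤ := by
      refine lt_of_le_of_lt ?_ (ENNReal.add_lt_top.2 ⟨hA, hB⟩)
      rw [modular, modular, modular, ← lintegral_add_left' (H.aemeasurable_modular ha)]
      refine lintegral_mono_ae ?_
      filter_upwards [ae_restrict_mem H.isOpen.measurableSet] with x hx
      simp only [enorm_rpow_eq_ofReal _ (H.pos_apply hx).le]
      rw [← ENNReal.ofReal_add (by positivity) (by positivity)]
      refine ENNReal.ofReal_le_ofReal ?_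
      have h1 := slope_norm_rpow_le (H.one_lt_apply hx) (a x) (k x) ht ht1
      rw [inv_mul_le_iff₀ ht] at h1
      simp only [Pi.add_apply, Pi.smul_apply]
      have h2 : 0 ≤ ‖a x‖ ^ p x := by positivity
      have h3 : 0 ≤ ‖a x + k x‖ ^ p x := by positivity
      nlinarith
    have it := H.integrable_norm_rpow hm hfin
    have iS : Integrable (S t) μ := (it.sub iA).const_mul _
    have hS0 : 0 ≤ ∫ x, S t x ∂μ := by
      have h1 := hmin t ht ht1
      rw [H.modular_eq_ofReal_integral ha hA, H.modular_eq_ofReal_integral hm hfin,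
        ENNReal.ofReal_le_ofReal_iff (integral_nonneg fun x => by positivity)] at h1
      have h2 : ∫ x, S t x ∂μ = t⁻¹ * (∫ x, ‖(a + t • k) x‖ ^ p x ∂μ - ∫ x, ‖a x‖ ^ p x ∂μ) := by
        rw [← integral_sub it iA, ← integral_const_mul]
        rfl
      rw [h2]
      exact mul_nonneg (by positivity) (sub_nonneg.2 h1)
    refine ⟨iS.aemeasurable, ?_⟩
    have iQS : Integrable (fun x => Q x - S t x) μ := iQ.sub iS
    rw [← ofReal_integral_eq_lintegral_ofReal iQS
      (by filter_upwards [hSQ t ht ht1] with x hx using sub_nonneg.2 hx)]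
    refine ENNReal.ofReal_le_ofReal ?_
    rw [integral_sub iQ iS]
    linarith
  have hQ0 : 0 ≤ ∫ x, Q x ∂μ := by
    have h1 := hmin 1 one_pos le_rfl
    rw [one_smul, H.modular_eq_ofReal_integral ha hA, H.modular_eq_ofReal_integral (ha.add hk) hB,
      ENNReal.ofReal_le_ofReal_iff (integral_nonneg fun x => by positivity)] at h1
    rw [hQ, integral_sub iB iA]
    exact sub_nonneg.2 h1
  have hQD : 0 ≤ᵐ[μ] fun x => Q x - D x := by
    filter_upwards [ae_restrict_mem H.isOpen.measurableSet] with x hx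
    have := norm_rpow_add_le (H.one_lt_apply hx) (a x) (k x)
    simp only [hQ, hD, Pi.add_apply, Pi.zero_apply]
    linarith
  -- Fatou's lemma as `t → 0` replaces `S t` by its pointwise limit `D`. The resulting bound gives
  -- integrability of `Q - D`, hence of `D`, and then `∫ D ≥ 0`.
  have hfatou : ∫⁻ x, ENNReal.ofReal (Q x - D x) ∂μ ≤ ENNReal.ofReal (∫ x, Q x ∂μ) := by
    set τ : ℕ → ℝ := fun j => 1 / ((j : ℝ) + 1) with hτ
    have hτ0 : ∀ j, 0 < τ j := fun j => Nat.one_div_pos_of_nat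
    have hτ1 : ∀ j, τ j ≤ 1 := fun j => by
      rw [hτ, div_le_one (by positivity)]
      simp
    have hτl : Tendsto τ atTop (𝓝[>] 0) :=
      tendsto_nhdsWithin_iff.2 ⟨tendsto_one_div_add_atTop_nhds_zero_nat,
        Eventually.of_forall hτ0⟩
    calc ∫⁻ x, ENNReal.ofReal (Q x - D x) ∂μ
        = ∫⁻ x, liminf (fun j => ENNReal.ofReal (Q x - S (τ j) x)) atTop ∂μ := by
          refine lintegral_congr_ae ?_
          filter_upwards [ae_restrict_mem H.isOpen.measurableSet] with x hx
          have h1 := (tendsto_slope_norm_rpow (H.one_lt_apply hx) (a x) (k x)).comp hτl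
          exact (ENNReal.tendsto_ofReal (h1.const_sub (Q x))).liminf_eq.symm
      _ ≤ liminf (fun j => ∫⁻ x, ENNReal.ofReal (Q x - S (τ j) x) ∂μ) atTop :=
          lintegral_liminf_le' fun j =>
            (iQ.aemeasurable.sub (bound _ (hτ0 j) (hτ1 j)).1).ennreal_ofReal
      _ ≤ _ := liminf_le_of_frequently_le'
          (Frequently.of_forall fun j => (bound _ (hτ0 j) (hτ1 j)).2)
  have iQD : Integrable (fun x => Q x - D x) μ := by
    refine ⟨iQ.aestronglyMeasurable.sub hDm, ?_⟩
    rw [hasFiniteIntegral_iff_ofReal hQD]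
    exact hfatou.trans_lt ENNReal.ofReal_lt_top
  have iD : Integrable D μ := 
    (iQ.sub iQD).congr (Eventually.of_forall fun x => by simp)
  refine ⟨iD, ?_⟩
  rw [← ofReal_integral_eq_lintegral_ofReal iQD hQD, ENNReal.ofReal_le_ofReal_iff hQ0,
    integral_sub iQ iD] at hfatou
  linarith

lemma variationalInequality_of_isEnergyMinimizer (H : ExponentBound Ω p q) {φ h : Space n → ℝ}
    (hφ : φ ∈ sobolevSpace Ω p) (hE : modular Ω p (weakGradient Ω φ) < ⊤)
    (hh : IsEnergyMinimizer Ω p φ h) : VariationalInequality Ω p φ (φ + h) := by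
  intro w hw hfin
  have gu := hasWeakGradient_of_mem (H.sobolevSpace_add_mem hφ (H.V0_subset_sobolevSpace hh.1))
  have gw := hasWeakGradient_of_mem (H.V0_subset_sobolevSpace hw)
  have gφ := hasWeakGradient_of_mem hφ
  set a := weakGradient Ω (φ + h) with ha
  have gwφ := gw.sub H.isOpen gφ
  have gk : HasWeakGradient Ω (w + (φ + h) - φ)
      (weakGradient Ω w - weakGradient Ω φ + a) := by
    convert gwφ.add H.isOpen gu using 1
    abel
  set k := weakGradient Ω w - weakGradient Ω φ + a with hk
  have hA : modular Ω p a < ⊤ :=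
    hh.2.trans_lt (H.minEnergy_ne_top hφ hE).lt_top
  -- The competitor is `φ - w`: moving from `a` by `-k` reaches its gradient, which has the same
  -- norm as that of `w - φ`.
  have hB : modular Ω p (a + -k) < ⊤ := by
    refine lt_of_eq_of_lt (modular_congr ?_) hfin
    filter_upwards [gwφ.ae_eq H.isOpen] with x hx
    rw [hx, ← enorm_neg]
    congr 1
    simp [hk]
  obtain ⟨h1, h2⟩ := H.first_variation gu.aestronglyMeasurable_gradient
    gk.neg.aestronglyMeasurable_gradient hA hB fun t ht ht1 => by
      have hV : h + t • (-w - h) ∈ V0 Ω p := H.V0_add_mem hh.1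
        (H.V0_smul_mem_of_abs_le_one (by rwa [abs_of_pos ht])
          (H.V0_sub_mem (H.V0_neg_mem hw) hh.1))
      have g : HasWeakGradient Ω (φ + (h + t • (-w - h))) (a + t • -k) := by
        convert gu.add H.isOpen (gk.neg.smul t) using 1
        module
      rw [← H.energy_eq g]
      exact hh.2.trans (minEnergy_le hV)
  have hflux := gu.flux_ae_eq (p := p) H.isOpen gk
  have hneg : ∀ x, p x * ‖a x‖ ^ (p x - 2) * inner ℝ (a x) ((-k) x) =
      -(p x * ‖a x‖ ^ (p x - 2) * inner ℝ (a x) (k x)) := fun x => by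
    rw [Pi.neg_apply, inner_neg_right, mul_neg]
  simp only [hneg] at h1 h2
  rw [integral_neg] at h2
  refine ⟨Integrable.congr ?_ hflux.symm, ?_⟩
  · exact (Integrable.neg h1).congr (Eventually.of_forall fun x => by simp)
  · rw [integral_congr_ae hflux]
    linarith

lemma isEnergyMinimizer_of_variationalInequality (H : ExponentBound Ω p q) {φ u : Space n → ℝ}
    (hφ : φ ∈ sobolevSpace Ω p) (hu : u ∈ sobolevSpace Ω p) (hV : u - φ ∈ V0 Ω p)
    (h : VariationalInequality Ω p φ u) : IsEnergyMinimizer Ω p φ (u - φ) := by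
  refine ⟨hV, le_iInf₂ fun w hw => ?_⟩
  rcases eq_or_ne (energy Ω p φ w) ⊤ with htop | hfin
  · rw [htop]; exact le_top
  have gu := hasWeakGradient_of_mem hu
  have gv := hasWeakGradient_of_mem (H.sobolevSpace_add_mem hφ (H.V0_subset_sobolevSpace hw))
  have gk : HasWeakGradient Ω (-w + u - φ) (weakGradient Ω u - weakGradient Ω (φ + w)) := by
    convert gu.sub H.isOpen gv using 1
    abel
  have gn : HasWeakGradient Ω (-w - φ) (-weakGradient Ω (φ + w)) := by
    convert gv.neg using 1
    abel
  rw [H.energy_eq (g := weakGradient Ω u) (by simpa using gu)]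
  set a := weakGradient Ω u with ha
  set b := weakGradient Ω (φ + w) with hb
  have hB : modular Ω p b < ⊤ := lt_top_iff_ne_top.2 hfin
  obtain ⟨h1, h2⟩ := h (-w) (H.V0_neg_mem hw) <| by
    refine lt_of_eq_of_lt (modular_congr ?_) hB
    filter_upwards [gn.ae_eq H.isOpen] with x hx
    rw [hx, Pi.neg_apply, enorm_neg]
  have iB := H.integrable_norm_rpow gv.aestronglyMeasurable_gradient hB
  -- This is the tangent inequality at `a` evaluated at `b`. It also supplies the finiteness of the
  -- energy of `u`, which is not assumed.
  have hle : ∀ᵐ x ∂volume.restrict Ω,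
      ‖a x‖ ^ p x ≤ ‖b x‖ ^ p x + flux Ω p u (-w + u - φ) x := by
    filter_upwards [ae_restrict_mem H.isOpen.measurableSet,
      gu.flux_ae_eq (p := p) H.isOpen gk] with x hx hf
    have h3 := norm_rpow_add_le (H.one_lt_apply hx) (a x) (-(a x - b x))
    rw [inner_neg_right, neg_sub, add_sub_cancel, mul_neg] at h3
    rw [hf, Pi.sub_apply]
    linarith
  rw [energy, ← hb, H.modular_eq_ofReal_integral gv.aestronglyMeasurable_gradient hB,
    H.modular_eq_lintegral_ofReal]
  calc ∫⁻ x in Ω, ENNReal.ofReal (‖a x‖ ^ p x)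
      ≤ ∫⁻ x in Ω, ENNReal.ofReal (‖b x‖ ^ p x + flux Ω p u (-w + u - φ) x) := by
        refine lintegral_mono_ae ?_
        filter_upwards [hle] with x hx using ENNReal.ofReal_le_ofReal hx
    _ = ENNReal.ofReal (∫ x in Ω, ‖b x‖ ^ p x + flux Ω p u (-w + u - φ) x) := by
        refine (ofReal_integral_eq_lintegral_ofReal (iB.add h1) ?_).symm
        filter_upwards [hle] with x hx
        exact le_trans (by positivity) hx
    _ ≤ _ := by
        refine ENNReal.ofReal_le_ofReal ?_
        rw [integral_add iB h1]
        linarith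

/-- On the compact support of `θ` the continuous exponent is bounded, so doubling is available
there; off the support nothing changes. -/
lemma modular_add_gradient_lt_top (H : ExponentBound Ω p q) (hp : ContinuousOn p Ω)
    {a : Space n → Space n} (hA : modular Ω p a < ⊤)
    {θ : Space n → ℝ} (hθ : θ ∈ testFunctions Ω) : modular Ω p (a + gradient θ) < ⊤ := by
  obtain ⟨N, hN⟩ := (hθ.1.continuous_fderiv (by simp)).bounded_above_of_compact_support
    (hθ.2.1.fderiv ℝ)
  obtain ⟨P, hP⟩ := IsCompact.bddAbove_image hθ.2.1 (hp.mono hθ.2.2)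
  -- With `M ≥ 1` the power `M ^ p x` is monotone in the exponent, so it is at most `M ^ |P|` on the
  -- support.
  set M := max N 1 with hM
  have hM1 : 1 ≤ M := le_max_right _ _
  have key : ∀ x ∈ Ω, ‖a x + gradient θ x‖ ^ p x ≤
      2 ^ |P| * (‖a x‖ ^ p x + M ^ |P|) := by
    intro x hx
    have hp0 := (H.pos_apply hx).le
    have h2 : 1 ≤ (2 : ℝ) ^ |P| := Real.one_le_rpow (by norm_num) (abs_nonneg _)
    by_cases hxK : x ∈ tsupport θ
    · have hpP : p x ≤ |P| := (hP ⟨x, hxK, rfl⟩).trans (le_abs_self P)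
      have h3 : ‖a x + gradient θ x‖ ≤ 2 * max ‖a x‖ M := by
        have h4 : ‖gradient θ x‖ ≤ M := ((norm_gradient θ x).trans_le (hN x)).trans (le_max_left _ _)
        have := norm_add_le (a x) (gradient θ x)
        linarith [le_max_left ‖a x‖ M, le_max_right ‖a x‖ M]
      have h4 : (max ‖a x‖ M) ^ p x ≤ ‖a x‖ ^ p x + M ^ |P| := by
        have h5 : 0 ≤ M ^ |P| := by positivity
        have h6 : 0 ≤ ‖a x‖ ^ p x := by positivity
        have h7 : M ^ p x ≤ M ^ |P| := Real.rpow_le_rpow_of_exponent_le hM1 hpP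
        rcases max_cases ‖a x‖ M with ⟨h, _⟩ | ⟨h, _⟩ <;> rw [h] <;> linarith
      calc ‖a x + gradient θ x‖ ^ p x ≤ (2 * max ‖a x‖ M) ^ p x :=
            Real.rpow_le_rpow (norm_nonneg _) h3 hp0
        _ = 2 ^ p x * (max ‖a x‖ M) ^ p x := Real.mul_rpow (by norm_num) (by positivity)
        _ ≤ _ := by
            gcongr
            norm_num
    · have h3 : gradient θ x = 0 := by
        rw [← norm_eq_zero, norm_gradient, norm_eq_zero]
        exact image_eq_zero_of_notMem_tsupport fun h => hxK (tsupport_fderiv_subset ℝ h)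
      rw [h3, add_zero]
      have h5 : 0 ≤ M ^ |P| := by positivity
      have h6 : 0 ≤ ‖a x‖ ^ p x := by positivity
      nlinarith
  rw [H.modular_eq_lintegral_ofReal] at hA ⊢
  have hle : ∫⁻ x in Ω, ENNReal.ofReal (‖(a + gradient θ) x‖ ^ p x) ≤
      ∫⁻ x in Ω, ENNReal.ofReal (2 ^ |P|) *
        (ENNReal.ofReal (‖a x‖ ^ p x) + ENNReal.ofReal (M ^ |P|)) := by
    refine lintegral_mono_ae ?_
    filter_upwards [ae_restrict_mem H.isOpen.measurableSet] with x hx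
    rw [← ENNReal.ofReal_add (by positivity) (by positivity), ← ENNReal.ofReal_mul (by positivity)]
    exact ENNReal.ofReal_le_ofReal (key x hx)
  refine hle.trans_lt ?_
  rw [lintegral_const_mul' _ _ ENNReal.ofReal_ne_top, lintegral_add_right _ measurable_const]
  refine ENNReal.mul_lt_top ENNReal.ofReal_lt_top (ENNReal.add_lt_top.2 ⟨hA, ?_⟩)
  rw [setLIntegral_const]
  exact ENNReal.mul_lt_top ENNReal.ofReal_lt_top H.volume_lt_top

lemma isSolution_of_variationalInequality (H : ExponentBound Ω p q) (hp : ContinuousOn p Ω)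
    {φ u : Space n → ℝ} (hu : u ∈ sobolevSpace Ω p)
    (hV : u - φ ∈ V0 Ω p) (hA : modular Ω p (weakGradient Ω u) < ⊤)
    (h : VariationalInequality Ω p φ u) : IsSolution Ω p φ u := by
  have gu := hasWeakGradient_of_mem hu
  have key : ∀ θ ∈ testFunctions Ω,
      IntegrableOn (flux Ω p u θ) Ω ∧ ∫ x in Ω, flux Ω p u θ x ≤ 0 := by
    intro θ hθ
    have gθ := hasWeakGradient_of_mem_testFunctions hθ
    -- This choice of `w` turns `w + u - φ` into `θ` and `w - φ` into `θ - u`, which has finite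
    -- energy.
    have h1 := h (θ - (u - φ)) (H.V0_sub_mem (testFunctions_subset_V0 hθ) hV) <| by
      have g : HasWeakGradient Ω (θ - (u - φ) - φ) (-weakGradient Ω u + gradient θ) := by
        convert gu.neg.add H.isOpen gθ using 1
        abel
      rw [modular_congr (f := weakGradient Ω _) (g := -weakGradient Ω u + gradient θ)]
      · refine H.modular_add_gradient_lt_top hp ?_ hθ
        rwa [modular_congr (g := weakGradient Ω u) (Eventually.of_forall fun x => by simp)]
      · filter_upwards [g.ae_eq H.isOpen] with x hx
        rw [hx]
    have e : θ - (u - φ) + u - φ = θ := by abel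
    rwa [e] at h1
  refine ⟨hu, hV, fun θ hθ => ⟨(key θ hθ).1, le_antisymm (key θ hθ).2 ?_⟩⟩
  have gθ := hasWeakGradient_of_mem_testFunctions hθ
  have h1 := (key (-θ) (by simpa using testFunctions_smul_mem hθ (-1))).2
  have h2 : flux Ω p u (-θ) =ᵐ[volume.restrict Ω] fun x => -flux Ω p u θ x := by
    filter_upwards [gu.flux_ae_eq (p := p) H.isOpen gθ,
      gu.flux_ae_eq (p := p) H.isOpen gθ.neg] with x h3 h4
    rw [h3, h4, Pi.neg_apply, inner_neg_right, mul_neg]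
  rw [integral_congr_ae h2, integral_neg] at h1
  linarith

end ExponentBound

lemma exists_exponentBound {n : ℕ} (hn : 1 ≤ n) {Ω : Set (Space n)} (hΩ_open : IsOpen Ω)
    (hΩ_bdd : Bornology.IsBounded Ω) {p : Space n → ℝ} (hp : ContinuousOn p Ω)
    (hpn : ((n : ℝ) : EReal) < ⨅ x ∈ Ω, (p x : EReal)) :
    ∃ q : ℝ, (n : ℝ) < q ∧ ExponentBound Ω p q := by
  obtain ⟨q, hnq, hq⟩ := EReal.lt_iff_exists_real_btwn.1 hpn
  have hnq' : (n : ℝ) < q := by exact_mod_cast hnq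
  have hn' : (1 : ℝ) ≤ n := by exact_mod_cast hn
  refine ⟨q, hnq', hΩ_open, hΩ_bdd.measure_lt_top, hp.aemeasurable hΩ_open.measurableSet,
    hn'.trans_lt hnq', fun x hx => ?_⟩
  exact_mod_cast hq.le.trans (iInf₂_le x hx)

end VarExp

theorem mainTheorem4 (n : ℕ) (hn : 1 ≤ n) (Ω : Set (VarExp.Space n))
    (hΩ_open : IsOpen Ω) (hΩ_conn : IsConnected Ω) (hΩ_bdd : Bornology.IsBounded Ω)
    (hΩ_bdry : VarExp.HasC2Boundary Ω)
    (p : VarExp.Space n → ℝ) (hp : ContinuousOn p Ω)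
    (hpn : ((n : ℝ) : EReal) < ⨅ x ∈ Ω, (p x : EReal))
    (φ : VarExp.Space n → ℝ) (hφ : φ ∈ VarExp.sobolevSpace Ω p)
    (hφ_energy : VarExp.modular Ω p (VarExp.weakGradient Ω φ) < ⊤) :
    ∃ u : VarExp.Space n → ℝ,
      (VarExp.IsSolution Ω p φ u ∧ VarExp.VariationalInequality Ω p φ u) ∧
      ∀ u' : VarExp.Space n → ℝ,
        VarExp.IsSolution Ω p φ u' ∧ VarExp.VariationalInequality Ω p φ u' →
          u' =ᵐ[MeasureTheory.volume.restrict Ω] u := by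
  obtain ⟨q, hnq, H⟩ := VarExp.exists_exponentBound hn hΩ_open hΩ_bdd hp hpn
  obtain ⟨C, hC⟩ := H.exists_isPoincareConstant hn hnq hΩ_bdd
  obtain ⟨h, hh⟩ := H.exists_isEnergyMinimizer hC hφ hφ_energy
  have hVI := H.variationalInequality_of_isEnergyMinimizer hφ hφ_energy hh
  refine ⟨φ + h, ⟨H.isSolution_of_variationalInequality hp
    (H.sobolevSpace_add_mem hφ (H.V0_subset_sobolevSpace hh.1)) (by simpa using hh.1)
    (hh.2.trans_lt (H.minEnergy_ne_top hφ hφ_energy).lt_top) hVI, hVI⟩, fun u hu => ?_⟩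
  have hu' := H.isEnergyMinimizer_of_variationalInequality hφ hu.1.1 hu.1.2.1 hu.2
  filter_upwards [H.ae_eq_of_isEnergyMinimizer hC hφ hφ_energy hu' hh] with x hx
  rw [Pi.add_apply, ← hx, Pi.sub_apply, add_sub_cancel]
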